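/- Let $K$ be a number field of degree $m$ with ring of integers $\mathcal O_K$ and adele ring $\mathbb A$, and let $n\ge 2$. A Humbert form of dimension $n$ over $K$ is a tuple $S=(S_v)_{v\mid\infty}$ of positive definite $n\times n$ matrices, real symmetric for $v$ real and complex hermitian for $v$ complex. For $x\in\mathcal O_K^n$ put $$S[x]=\prod_{v\text{ real}}S_v[x^{\sigma_v}]\cdot\Big(\prod_{v\text{ complex}}S_v[x^{\sigma_v}]\Big)^2,\qquad \det S=\prod_{v\text{ real}}\det S_v\cdot\Big(\prod_{v\text{ complex}}\det S_v\Big)^2,$$ where $\sigma_v$ is an embedding of $K$ inducing $v$ and $S_v[z]=z^*S_vz$. With $\mathrm N\langle x\rangle$ the norm of the ideal generated by the coordinates of $x$, the projective Hermite–Humbert constant is $$\gamma^p(n,K)=\sup_S\ \inf_{0\neq x\in\mathcal O_K^n}\frac{S[x]}{\mathrm N\langle x\rangle^2\,\det(S)^{1/n}} .$$ Let $|\cdot|_v$ be the normalized absolute values of the completions $K_v$, let $|a|_{\mathbb A}=\prod_v|a_v|_v$ for an idele $a$, and let $H(y)=\prod_vH_v(y_v)$ for $y\in\mathbb A^n$,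 where $H_v(y)$ equals $(\sum_i|y_i|_v^2)^{1/(2m)}$, $(\sum_i|y_i|_v)^{1/m}$ or $(\max_i|y_i|_v)^{1/m}$ according as $v$ is real, complex or finite. Let $\rho$ be the standard representation of $G=\mathrm{SL}_n$, let $Q$ be the stabilizer in $G$ of the highest weight line spanned by the first basis vector $e_1$, let $H_\rho(g)=H(\rho(g)^{-1}e_1)$ for $g\in G(\mathbb A)$, and let $G(\mathbb A)^1$ be the set of $g\in G(\mathbb A)$ with $|\chi(g)|_{\mathbb A}=1$ for all $K$-rational characters $\chi$ of $G$. Watanabe's constant is $$\gamma^W(\mathrm{SL}_n,\rho)=\sup_{g\in G(\mathbb A)^1}\ \inf_{x\in Q(K)\backslash G(K)}H_\rho(xg)^2 .$$ Then both constants are finite and $$\gamma^p(n,K)=\gamma^W(\mathrm{SL}_n,\rho)^m .$$ Consequently, if $K$ is an imaginary quadratic field, regarded as a subfield of $\mathbb C$ through either of its embeddings, then $\gamma^W(\mathrm{SL}_2,\rho)=\gamma^p_K$, where $\gamma_K^p$ is the projective Hermite constant $$\gamma_K^p=\sup_S\ \inf_{0\ne v\in\mathcal O_K^2}\frac{S[v]}{\mathrm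 N\langle v\rangle\,\det(S)^{1/2}},$$ the supremum being over all positive definite binary hermitian forms $S$. Thus every known value of $\gamma_K^p$ is the value of $\gamma^W(\mathrm{SL}_2,\rho)$ over $K$. -/

import Mathlib

open NumberField IsDedekindDomain Matrix
open scoped ENNReal ComplexOrder

noncomputable section

namespace HermiteHumbert

universe u

/-! ### Humbert forms and the projective Hermite-Humbert constant -/

/-- An `n`-dimensional Humbert form over `K`: a positive definite real symmetric `n × n` matrix for
each real place of `K` and a positive definite complex hermitian one for each complex place. -/
structure HumbertForm (K : Type u) [Field K] (n : ℕ) where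
  realPart : {v : InfinitePlace K // v.IsReal} → Matrix (Fin n) (Fin n) ℝ
  complexPart : {v : InfinitePlace K // v.IsComplex} → Matrix (Fin n) (Fin n) ℂ
  realPart_posDef : ∀ v, (realPart v).PosDef
  complexPart_posDef : ∀ v, (complexPart v).PosDef

/-- The value `A[z] = z* A z` of a complex hermitian matrix `A` at `z`; this is a real number. -/
def hermitianValue {n : ℕ} (A : Matrix (Fin n) (Fin n) ℂ) (z : Fin n → ℂ) : ℝ :=
  (star z ⬝ᵥ (A *ᵥ z)).re

open scoped Classical in
/-- The value `S[x]`: the product of the values of the components of `S` at the conjugates of `x`,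
the complex places counted twice. -/
def HumbertForm.eval {K : Type u} [Field K] [NumberField K] {n : ℕ} (S : HumbertForm K n)
    (x : Fin n → 𝓞 K) : ℝ :=
  (∏ v : {v : InfinitePlace K // v.IsReal},
      (fun i => InfinitePlace.embedding_of_isReal v.2 (x i : K)) ⬝ᵥ
        (S.realPart v *ᵥ fun i => InfinitePlace.embedding_of_isReal v.2 (x i : K))) *
    (∏ v : {v : InfinitePlace K // v.IsComplex},
      hermitianValue (S.complexPart v) fun i => v.1.embedding (x i : K)) ^ 2

open scoped Classical in
/-- The determinant of a Humbert form, the complex places counted twice. -/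
def HumbertForm.det {K : Type u} [Field K] [NumberField K] {n : ℕ} (S : HumbertForm K n) : ℝ :=
  (∏ v : {v : InfinitePlace K // v.IsReal}, (S.realPart v).det) *
    (∏ v : {v : InfinitePlace K // v.IsComplex}, (S.complexPart v).det.re) ^ 2

/-- The norm of the ideal `⟨x⟩` generated by the coordinates of an integral vector `x`. -/
def contentNorm {K : Type u} [Field K] [NumberField K] {n : ℕ} (x : Fin n → 𝓞 K) : ℝ :=
  (Ideal.absNorm (Ideal.span (Set.range x)) : ℝ)

/-- The `n`-dimensional projective Hermite-Humbert constant `γ^p(n, K)`, as an element of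
`[0, ∞]`, so that the supremum has no junk value. -/
def projHermiteHumbert (n : ℕ) (K : Type u) [Field K] [NumberField K] : ℝ≥0∞ :=
  ⨆ S : HumbertForm K n, ⨅ x : {x : Fin n → 𝓞 K // x ≠ 0},
    ENNReal.ofReal (S.eval x.1 / (contentNorm x.1 ^ 2 * S.det ^ (1 / (n : ℝ))))

/-- The projective Hermite constant `γ_K^p` of an imaginary quadratic field `K`, regarded as a
subfield of `ℂ` through the embedding `σ`: it is defined by positive definite binary hermitian
forms. -/
def binaryProjHermite {K : Type u} [Field K] [NumberField K] (σ : K →+* ℂ) : ℝ≥0∞ :=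
  ⨆ S : {S : Matrix (Fin 2) (Fin 2) ℂ // S.PosDef}, ⨅ x : {x : Fin 2 → 𝓞 K // x ≠ 0},
    ENNReal.ofReal (hermitianValue S.1 (fun i => σ (x.1 i : K)) /
      (contentNorm x.1 * S.1.det.re ^ (1 / 2 : ℝ)))

/-! ### Absolute values and heights on adelic vectors -/

/-- The normalized absolute value `|·|_v` at an infinite place (the usual absolute value at a real
place and its square at a complex place). -/
def infAbs {K : Type u} [Field K] (v : InfinitePlace K) (a : v.Completion) : ℝ :=
  ‖a‖ ^ v.mult

/-- The normalized absolute value `|·|_v` at a finite place: Mathlib's norm on the completion is the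
one for which a uniformizer has norm `1 / N(v)`. -/
def finAbs {K : Type u} [Field K] [NumberField K] (v : HeightOneSpectrum (𝓞 K))
    (a : v.adicCompletion K) : ℝ :=
  ‖a‖

/-- The component of an adele at an infinite place. -/
def infComp {K : Type u} [Field K] [NumberField K] (v : InfinitePlace K) :
    AdeleRing (𝓞 K) K →+* v.Completion where
  toFun a := a.1 v
  map_one' := rfl
  map_mul' _ _ := rfl
  map_zero' := rfl
  map_add' _ _ := rfl

/-- The component of an adele at a finite place. -/
def finComp {K : Type u} [Field K] [NumberField K] (v : HeightOneSpectrum (𝓞 K)) :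
    AdeleRing (𝓞 K) K →+* v.adicCompletion K where
  toFun a := a.2 v
  map_one' := rfl
  map_mul' _ _ := rfl
  map_zero' := rfl
  map_add' _ _ := rfl

/-- The adelic norm `|a|_𝔸 = ∏_v |a_v|_v` (used for ideles only, where almost all factors
are `1`). -/
def adelicNorm {K : Type u} [Field K] [NumberField K] (a : AdeleRing (𝓞 K) K) : ℝ :=
  (∏ v : InfinitePlace K, infAbs v (infComp v a)) *
    ∏ᶠ v : HeightOneSpectrum (𝓞 K), finAbs v (finComp v a)

open scoped Classical in
/-- The local height `H_v` at an infinite place. -/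
def infHeight {K : Type u} [Field K] [NumberField K] {n : ℕ} (v : InfinitePlace K)
    (y : Fin n → v.Completion) : ℝ :=
  if v.IsReal then (∑ i, infAbs v (y i) ^ 2) ^ (1 / (2 * (Module.finrank ℚ K : ℝ)))
  else (∑ i, infAbs v (y i)) ^ (1 / (Module.finrank ℚ K : ℝ))

/-- The local height `H_v` at a finite place. -/
def finHeight {K : Type u} [Field K] [NumberField K] {n : ℕ} (v : HeightOneSpectrum (𝓞 K))
    (y : Fin n → v.adicCompletion K) : ℝ :=
  (⨆ i, finAbs v (y i)) ^ (1 / (Module.finrank ℚ K : ℝ))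

/-- The global height `H(y) = ∏_v H_v(y_v)` of an adelic vector. It is used for `y = g x` with
`g ∈ GL_n(𝔸)` and `0 ≠ x ∈ K^n`, where almost all factors are `1`. -/
def height {K : Type u} [Field K] [NumberField K] {n : ℕ} (y : Fin n → AdeleRing (𝓞 K) K) : ℝ :=
  (∏ v : InfinitePlace K, infHeight v fun i => infComp v (y i)) *
    ∏ᶠ v : HeightOneSpectrum (𝓞 K), finHeight v fun i => finComp v (y i)

/-! ### The height is invariant under `K^×` on unimodular vectors -/

theorem infAbs_mul {K : Type u} [Field K] (v : InfinitePlace K) (a b : v.Completion) :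
    infAbs v (a * b) = infAbs v a * infAbs v b := by
  simp [infAbs, mul_pow]

theorem infAbs_nonneg {K : Type u} [Field K] (v : InfinitePlace K) (a : v.Completion) :
    0 ≤ infAbs v a := by
  unfold infAbs; positivity

theorem finAbs_nonneg {K : Type u} [Field K] [NumberField K] (v : HeightOneSpectrum (𝓞 K))
    (a : v.adicCompletion K) : 0 ≤ finAbs v a :=
  norm_nonneg a

theorem infAbs_coe {K : Type u} [Field K] (v : InfinitePlace K) (c : K) :
    infAbs v (c : v.Completion) = v c ^ v.mult := by
  unfold infAbs
  exact congrArg (fun t : ℝ => t ^ v.mult)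
    (InfinitePlace.Completion.norm_coe v (WithAbs.toAbs v.1 c))

theorem infHeight_mul {K : Type u} [Field K] [NumberField K] {n : ℕ} (v : InfinitePlace K)
    (a : v.Completion)
    (y : Fin n → v.Completion) :
    infHeight v (fun i => a * y i) =
      infAbs v a ^ (1 / (Module.finrank ℚ K : ℝ)) * infHeight v y := by
  unfold infHeight
  split_ifs with h
  · simp only [infAbs_mul, mul_pow, ← Finset.mul_sum]
    rw [Real.mul_rpow (sq_nonneg _) (Finset.sum_nonneg fun i _ => sq_nonneg _),
      ← Real.rpow_natCast (infAbs v a) 2, ← Real.rpow_mul (infAbs_nonneg v a)]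
    congr 2
    push_cast
    rw [one_div, mul_inv, one_div, ← mul_assoc, mul_inv_cancel₀ two_ne_zero, one_mul]
  · simp only [infAbs_mul, ← Finset.mul_sum]
    rw [Real.mul_rpow (infAbs_nonneg v a) (Finset.sum_nonneg fun i _ => infAbs_nonneg v _)]

theorem finHeight_mul {K : Type u} [Field K] [NumberField K] {n : ℕ}
    (v : HeightOneSpectrum (𝓞 K)) (a : v.adicCompletion K) (y : Fin n → v.adicCompletion K) :
    finHeight v (fun i => a * y i) =
      finAbs v a ^ (1 / (Module.finrank ℚ K : ℝ)) * finHeight v y := by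
  unfold finHeight finAbs
  simp only [norm_mul]
  rw [← Real.mul_iSup_of_nonneg (norm_nonneg a),
    Real.mul_rpow (norm_nonneg a) (Real.iSup_nonneg fun i => norm_nonneg _)]

/-- The local heights of a unimodular adelic vector are `1` at almost all finite places. -/
theorem finite_mulSupport_finHeight {K : Type u} [Field K] [NumberField K] {n : ℕ}
    (y z : Fin n → AdeleRing (𝓞 K) K) (h : z ⬝ᵥ y = 1) :
    (Function.mulSupport fun v : HeightOneSpectrum (𝓞 K) =>
      finHeight v fun i => finComp v (y i)).Finite := by
  have hint : ∀ w : Fin n → AdeleRing (𝓞 K) K,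
      ∀ᶠ v : HeightOneSpectrum (𝓞 K) in Filter.cofinite, ∀ i, Valued.v (finComp v (w i)) ≤ 1 := by
    intro w
    rw [Filter.eventually_all]
    exact fun i => (w i).2.2
  have key : ∀ᶠ v : HeightOneSpectrum (𝓞 K) in Filter.cofinite,
      (finHeight v fun i => finComp v (y i)) = 1 := by
    filter_upwards [hint y, hint z] with v hy hz
    have hsum : ∑ i, finComp v (z i) * finComp v (y i) = 1 := by
      have := congrArg (finComp v) h
      rw [dotProduct, map_sum, map_one] at this
      simpa only [map_mul] using this
    obtain ⟨i, hi⟩ : ∃ i, Valued.v (finComp v (y i)) = 1 := by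
      by_contra! hne
      have hlt : Valued.v (∑ i, finComp v (z i) * finComp v (y i)) < 1 := by
        refine Valuation.map_sum_lt _ one_ne_zero fun i _ => ?_
        rw [map_mul]
        exact (mul_le_mul' (hz i) le_rfl).trans_lt
          (by rw [one_mul]; exact lt_of_le_of_ne (hy i) (hne i))
      rw [hsum, map_one] at hlt
      exact lt_irrefl _ hlt
    have hle : ∀ j, finAbs v (finComp v (y j)) ≤ 1 := by
      intro j
      unfold finAbs
      rw [FinitePlace.norm_def]
      exact_mod_cast (WithZeroMulInt.toNNReal_le_one_iff
        (HeightOneSpectrum.one_lt_absNorm_nnreal v)).2 (hy j)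
    have hone : finAbs v (finComp v (y i)) = 1 := by
      unfold finAbs
      rw [FinitePlace.norm_def, hi, map_one, NNReal.coe_one]
    have : Nonempty (Fin n) := ⟨i⟩
    have hsup : (⨆ j, finAbs v (finComp v (y j))) = 1 :=
      le_antisymm (ciSup_le hle)
        (hone.symm.le.trans (le_ciSup (f := fun j => finAbs v (finComp v (y j)))
          (Set.finite_range _).bddAbove i))
    rw [finHeight, hsup, Real.one_rpow]
  exact key

/-- The product formula. -/
theorem product_formula {K : Type u} [Field K] [NumberField K] (c : Kˣ) :
    adelicNorm (algebraMap K (AdeleRing (𝓞 K) K) c) = 1 := by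
  have h := prod_abs_eq_one (K := K) c.ne_zero
  rw [← h, adelicNorm]
  congr 1
  · exact Finset.prod_congr rfl fun v _ => infAbs_coe v (c : K)
  · rw [← finprod_comp_equiv (FinitePlace.equivHeightOneSpectrum (K := K)).symm]
    exact finprod_congr fun v =>
      (FinitePlace.equivHeightOneSpectrum_symm_apply v (c : K)).symm

theorem height_smul {K : Type u} [Field K] [NumberField K] {n : ℕ} (c : Kˣ)
    (y z : Fin n → AdeleRing (𝓞 K) K) (h : z ⬝ᵥ y = 1) :
    height (algebraMap K (AdeleRing (𝓞 K) K) c • y) = height y := by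
  have hsup := finite_mulSupport_finHeight y z h
  have hc : (Function.mulSupport fun v : HeightOneSpectrum (𝓞 K) =>
      finAbs v (finComp v (algebraMap K (AdeleRing (𝓞 K) K) c))).Finite := by
    have h1 := (FinitePlace.hasFiniteMulSupport (K := K) c.ne_zero)
    refine (h1.image (FinitePlace.equivHeightOneSpectrum (K := K))).subset ?_
    intro v hv
    refine ⟨(FinitePlace.equivHeightOneSpectrum (K := K)).symm v, ?_, Equiv.apply_symm_apply _ _⟩
    intro h2
    exact hv ((FinitePlace.equivHeightOneSpectrum_symm_apply v (c : K)).symm.trans h2)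
  have hc' : (Function.mulSupport fun v : HeightOneSpectrum (𝓞 K) =>
      finAbs v (finComp v (algebraMap K (AdeleRing (𝓞 K) K) c)) ^
        (1 / (Module.finrank ℚ K : ℝ))).Finite := by
    refine hc.subset fun v hv h2 => hv ?_
    exact (congrArg (fun t : ℝ => t ^ (1 / (Module.finrank ℚ K : ℝ))) h2).trans
      (Real.one_rpow _)
  have hI : ∀ v : InfinitePlace K, (infHeight v fun i =>
      infComp v ((algebraMap K (AdeleRing (𝓞 K) K) c • y) i)) =
      infAbs v (infComp v (algebraMap K (AdeleRing (𝓞 K) K) c)) ^ (1 / (Module.finrank ℚ K : ℝ)) *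
        infHeight v fun i => infComp v (y i) :=
    fun v => infHeight_mul v _ _
  have hF : ∀ v : HeightOneSpectrum (𝓞 K), (finHeight v fun i =>
      finComp v ((algebraMap K (AdeleRing (𝓞 K) K) c • y) i)) =
      finAbs v (finComp v (algebraMap K (AdeleRing (𝓞 K) K) c)) ^ (1 / (Module.finrank ℚ K : ℝ)) *
        finHeight v fun i => finComp v (y i) :=
    fun v => finHeight_mul v _ _
  have hp := product_formula (K := K) c
  have hfp : (∏ᶠ v : HeightOneSpectrum (𝓞 K),
      finAbs v (finComp v (algebraMap K (AdeleRing (𝓞 K) K) c)) ^ (1 / (Module.finrank ℚ K : ℝ))) =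
      (∏ᶠ v : HeightOneSpectrum (𝓞 K),
        finAbs v (finComp v (algebraMap K (AdeleRing (𝓞 K) K) c))) ^
          (1 / (Module.finrank ℚ K : ℝ)) := by
    rw [finprod_eq_prod_of_mulSupport_subset _ (s := hc.toFinset) (by
        intro v hv
        rw [Set.Finite.coe_toFinset]
        intro h2
        exact hv ((congrArg (fun t : ℝ => t ^ (1 / (Module.finrank ℚ K : ℝ))) h2).trans
          (Real.one_rpow _))),
      finprod_eq_prod _ hc, Real.finsetProd_rpow _ _ fun v _ => finAbs_nonneg _ _]
  unfold height
  simp only [hI, hF]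
  rw [finprod_mul_distrib hc' hsup, Finset.prod_mul_distrib, hfp,
    Real.finsetProd_rpow _ _ fun v _ => infAbs_nonneg _ _]
  rw [mul_mul_mul_comm, ← Real.mul_rpow (Finset.prod_nonneg fun v _ => infAbs_nonneg _ _)
    (finprod_nonneg fun v => finAbs_nonneg _ _)]
  unfold adelicNorm at hp
  rw [hp, Real.one_rpow, one_mul]

/-! ### Watanabe's constant of `SL_n` and its standard representation -/

/-- A `K`-rational character of the algebraic group `SL_n`: a morphism of group functors
`SL_n → GL_1` on commutative `K`-algebras. -/
structure RationalCharacter (n : ℕ) (K : Type u) [Field K] where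
  toFun : ∀ (R : Type u) [CommRing R] [Algebra K R], SpecialLinearGroup (Fin n) R →* Rˣ
  natural : ∀ (R R' : Type u) [CommRing R] [Algebra K R] [CommRing R'] [Algebra K R']
    (f : R →ₐ[K] R') (g : SpecialLinearGroup (Fin n) R),
    toFun R' (SpecialLinearGroup.map (f : R →+* R') g) =
      Units.map (f : R →* R') (toFun R g)

/-- For `G = SL_n`, the set `G(𝔸)¹` of all `g ∈ G(𝔸)` with `|χ(g)|_𝔸 = 1` for every `K`-rational
character `χ` of `G`. -/
def adelicPointsOne (n : ℕ) (K : Type u) [Field K] [NumberField K] :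
    Set (SpecialLinearGroup (Fin n) (AdeleRing (𝓞 K) K)) :=
  {g | ∀ χ : RationalCharacter n K,
    adelicNorm (χ.toFun (AdeleRing (𝓞 K) K) g : AdeleRing (𝓞 K) K) = 1}

/-- The first standard basis vector `e₁`. It spans the highest weight line of the standard
representation `ρ` of `SL_n` (with respect to the upper triangular Borel subgroup). -/
def highestWeightVector (n : ℕ) (R : Type u) [CommRing R] : Fin n → R :=
  fun i => if i.val = 0 then 1 else 0

/-- `Q(K)`, where `Q ⊆ SL_n` is the stabilizer of the highest weight line of `ρ`. -/
def lineStabilizer (n : ℕ) (K : Type u) [Field K] : Subgroup (SpecialLinearGroup (Fin n) K) where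
  carrier := {q | ∃ c : Kˣ, q.1 *ᵥ highestWeightVector n K = (c : K) • highestWeightVector n K}
  one_mem' := ⟨1, by simp⟩
  mul_mem' := by
    rintro a b ⟨c, hc⟩ ⟨d, hd⟩
    refine ⟨c * d, ?_⟩
    change (a.1 * b.1) *ᵥ _ = _
    rw [← mulVec_mulVec, hd, mulVec_smul, hc, smul_smul, Units.val_mul, mul_comm]
  inv_mem' := by
    rintro a ⟨c, hc⟩
    refine ⟨c⁻¹, ?_⟩
    have h1 : (a⁻¹).1 *ᵥ (a.1 *ᵥ highestWeightVector n K) = highestWeightVector n K := by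
      rw [mulVec_mulVec]
      change (a⁻¹ * a).1 *ᵥ _ = _
      simp
    rw [hc, mulVec_smul] at h1
    rw [← h1, smul_smul, Units.inv_mul, one_smul, h1]

/-- The height function `H_ρ` on `SL_n(𝔸)`: the height of `e₁ · g`, where `SL_n` acts on the right
of the space of `ρ` by `v · g = ρ(g)⁻¹ v`. -/
def rhoHeight {n : ℕ} {K : Type u} [Field K] [NumberField K]
    (g : SpecialLinearGroup (Fin n) (AdeleRing (𝓞 K) K)) : ℝ :=
  height ((g⁻¹).1 *ᵥ highestWeightVector n (AdeleRing (𝓞 K) K))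

/-- The diagonal embedding `SL_n(K) → SL_n(𝔸)`. -/
def toAdelic (n : ℕ) (K : Type u) [Field K] [NumberField K] :
    SpecialLinearGroup (Fin n) K →* SpecialLinearGroup (Fin n) (AdeleRing (𝓞 K) K) :=
  SpecialLinearGroup.map (algebraMap K (AdeleRing (𝓞 K) K))

/-- `g ↦ H_ρ(g)` is left invariant under `Q(K)`. -/
theorem rhoHeight_mul_left {n : ℕ} {K : Type u} [Field K] [NumberField K]
    (q : SpecialLinearGroup (Fin n) K) (hq : q ∈ lineStabilizer n K)
    (g : SpecialLinearGroup (Fin n) (AdeleRing (𝓞 K) K)) :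
    rhoHeight (toAdelic n K q * g) = rhoHeight g := by
  obtain ⟨c, hc⟩ := (lineStabilizer n K).inv_mem hq
  rcases n with _ | n
  · exact congrArg rhoHeight (Subsingleton.elim _ _)
  set e := highestWeightVector (n + 1) (AdeleRing (𝓞 K) K) with he
  have hmap : (algebraMap K (AdeleRing (𝓞 K) K)) ∘ highestWeightVector (n + 1) K = e := by
    funext i
    simp only [he, highestWeightVector, Function.comp_apply]
    split_ifs <;> simp
  have hq' : ((toAdelic (n + 1) K q)⁻¹).1 *ᵥ e = algebraMap K (AdeleRing (𝓞 K) K) c • e := by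
    rw [← map_inv, ← hmap]
    change ((q⁻¹).1.map (algebraMap K (AdeleRing (𝓞 K) K))) *ᵥ _ = _
    funext i
    rw [← RingHom.map_mulVec, hc]
    simp
  have h1 : ((toAdelic (n + 1) K q * g)⁻¹).1 *ᵥ e =
      algebraMap K (AdeleRing (𝓞 K) K) c • ((g⁻¹).1 *ᵥ e) := by
    rw [_root_.mul_inv_rev]
    change (g⁻¹.1 * ((toAdelic (n + 1) K q)⁻¹).1) *ᵥ e = _
    rw [← mulVec_mulVec, hq', mulVec_smul]
  unfold rhoHeight
  rw [h1]
  refine height_smul c _ (e ᵥ* g.1) ?_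
  have h2 : g.1 * g⁻¹.1 = 1 := congrArg Subtype.val (mul_inv_cancel g)
  rw [← dotProduct_mulVec, mulVec_mulVec, h2, one_mulVec]
  have h3 : e = Pi.single 0 1 := by
    funext i
    simp only [he, highestWeightVector, Pi.single_apply, Fin.ext_iff, Fin.val_zero]
  rw [h3, single_one_dotProduct, Pi.single_eq_same]

/-- For `g ∈ SL_n(𝔸)`, the function `x ↦ H_ρ(x g)` on `Q(K) \ SL_n(K)`. -/
def cosetHeight {n : ℕ} {K : Type u} [Field K] [NumberField K]
    (g : SpecialLinearGroup (Fin n) (AdeleRing (𝓞 K) K))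
    (x : Quotient (QuotientGroup.rightRel (lineStabilizer n K))) : ℝ :=
  Quotient.lift (fun x : SpecialLinearGroup (Fin n) K => rhoHeight (toAdelic n K x * g))
    (by
      intro a b hab
      have hq : b * a⁻¹ ∈ lineStabilizer n K := QuotientGroup.rightRel_apply.1 hab
      have := rhoHeight_mul_left (b * a⁻¹) hq (toAdelic n K a * g)
      rw [← mul_assoc, ← map_mul, inv_mul_cancel_right] at this
      exact this.symm) x

/-- Watanabe's constant `γ^W(SL_n, ρ)` over `K`, for the standard representation `ρ` of `SL_n`, as
an element of `[0, ∞]`. -/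
def watanabeSL (n : ℕ) (K : Type u) [Field K] [NumberField K] : ℝ≥0∞ :=
  ⨆ g : adelicPointsOne n K, ⨅ x : Quotient (QuotientGroup.rightRel (lineStabilizer n K)),
    ENNReal.ofReal (cosetHeight g.1 x ^ 2)

end HermiteHumbert

end

/-!
Both constants are suprema over the same group `SL_n(K ⊗ ℝ)`, up to an `m`-th power.

On the classical side, a positive definite matrix `A` is `det(A)^{1/n} P* P` with `P` of
determinant `1`, so that a Humbert form is, up to the factor `det(S)^{1/n}`, the form
`x ↦ ∏_v |M_v x|²` (complex places counted twice) of some `M ∈ SL_n(K ⊗ ℝ)`. This is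
`projHermiteHumbert_eq_iSup_mixedValue`.

On the adelic side, `SL_n(K_v)` is perfect, being generated by transvections, which are commutators;
hence rational characters are trivial and `G(𝔸)¹ = SL_n(𝔸)` (`adelicPointsOne_eq_univ`). The cosets
`Q(K) \ SL_n(K)` are the points of the projective space of `K^n` (`iInf_cosetHeight_eq`), and by the
product formula every point may be represented by an integral vector `x`. The infimum over
`x` depends only on the class of `g` modulo `SL_n(K)`, and strong approximation for `SL_n`
(`exists_mul_map_mem_integralSL`) supplies a representative of this class with finite components in
`SL_n(O_v)`. These do not change the finite local heights, whose product at `x` is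
`N⟨x⟩^{-1/m}`; the `2m`-th power of the height at `x` is therefore the value at `x` of the form
given by the archimedean part of `g`, divided by `N⟨x⟩²` (`twistedHeight_pow`). As every element of
`SL_n(K ⊗ ℝ)` is an archimedean part, `watanabeSL_pow` gives the same supremum as before.

Strong approximation is proved one place `w` at a time: the closure in `SL_n(K_w)` of the matrices
over the ring of elements of `K` integral away from `w` contains all transvections, because that
ring is dense in `K_w` by the Chinese remainder theorem, and transvections generate `SL_n(K_w)`.

Finiteness follows from Minkowski's theorem: an element of `SL_n(K ⊗ ℝ)` preserves the covolume of
the lattice `𝓞_K^n`, so that its image of the lattice has a nonzero point in a ball whose radius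
does not depend on the element (`exists_radius_forall_exists_norm_lt`), and `N⟨x⟩ ≥ 1`.

An imaginary quadratic field has a single infinite place, which is counted twice. Hence the binary
Humbert constant is the square of the one defined by hermitian forms
(`projHermiteHumbert_eq_binaryProjHermite_sq`), while `m = 2`.
-/

open NumberField IsDedekindDomain Matrix
open scoped ENNReal ComplexOrder

namespace HermiteHumbert

/-! ### The special linear group over a field -/

/-- Whitehead's factorization of the matrix `diag(c, c⁻¹)`: the first three factors give the
monomial matrix with entries `c` and `-c⁻¹`, the last three the inverse of the one for `c = 1`. -/
theorem diag2n_eq_prod_transvection {ι F : Type*} [Fintype ι] [DecidableEq ι] [Field F] {i j : ι}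
    (hij : i ≠ j) (c : F) (hc : c ≠ 0) :
    SpecialLinearGroup.diag2n hij c hc =
      SpecialLinearGroup.transvection hij c * SpecialLinearGroup.transvection hij.symm (-c⁻¹) *
        SpecialLinearGroup.transvection hij c * SpecialLinearGroup.transvection hij (-1) *
        SpecialLinearGroup.transvection hij.symm 1 * SpecialLinearGroup.transvection hij (-1) := by
  apply SpecialLinearGroup.coeMonoidHom_injective
  have hd : (SpecialLinearGroup.diag2n hij c hc).1 =
      1 + single i i (c - 1) + single j j (c⁻¹ - 1) := by
    ext k l
    simp only [SpecialLinearGroup.diag2n_coe, Matrix.add_apply, diagonal_apply, one_apply,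
      single_apply]
    split_ifs <;> grind
  simp only [SpecialLinearGroup.coeMonoidHom_apply, hd, Matrix.SpecialLinearGroup.coe_mul,
    SpecialLinearGroup.transvection_coe, mul_add, add_mul, one_mul, mul_one,
    single_mul_single_same, single_mul_single_of_ne _ _ _ _ hij,
    single_mul_single_of_ne _ _ _ _ hij.symm, zero_mul, add_zero, zero_add,
    mul_neg, neg_mul, mul_inv_cancel₀ hc, inv_mul_cancel₀ hc, sub_eq_add_neg, single_add,
    ← single_neg]
  abel

/-- Over a field, `SL_n` is generated by transvections. -/
theorem eq_top_of_transvection_mem {ι F : Type*} [Fintype ι] [DecidableEq ι] [Nontrivial ι]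
    [Field F] (H : Subgroup (SpecialLinearGroup ι F))
    (h : ∀ (i j : ι) (hij : i ≠ j) (c : F), SpecialLinearGroup.transvection hij c ∈ H) :
    H = ⊤ := by
  refine eq_top_iff.2 fun M _ => SpecialLinearGroup.diagonal_transvection_induction' (· ∈ H) M
    (fun i j hij c hc => ?_) h fun _ _ => mul_mem
  rw [diag2n_eq_prod_transvection hij c hc]
  exact mul_mem (mul_mem (mul_mem (mul_mem (mul_mem (h _ _ _ _) (h _ _ _ _)) (h _ _ _ _))
    (h _ _ _ _)) (h _ _ _ _)) (h _ _ _ _)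

theorem map_transvection {ι R S : Type*} [Fintype ι] [DecidableEq ι] [CommRing R] [CommRing S]
    (f : R →+* S) {i j : ι} (hij : i ≠ j) (c : R) :
    SpecialLinearGroup.map f (SpecialLinearGroup.transvection hij c) =
      SpecialLinearGroup.transvection hij (f c) := by
  apply SpecialLinearGroup.coeMonoidHom_injective
  ext k l
  simp [SpecialLinearGroup.transvection_coe, single_apply, one_apply, apply_ite f]

theorem diag2n_mul_transvection {ι F : Type*} [Fintype ι] [DecidableEq ι] [Field F] {i j : ι}
    (hij : i ≠ j) (a b : F) (ha : a ≠ 0) :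
    SpecialLinearGroup.diag2n hij a ha * SpecialLinearGroup.transvection hij b =
      SpecialLinearGroup.transvection hij (a ^ 2 * b) * SpecialLinearGroup.diag2n hij a ha := by
  apply SpecialLinearGroup.coeMonoidHom_injective
  ext k l
  simp only [SpecialLinearGroup.coeMonoidHom_apply, Matrix.SpecialLinearGroup.coe_mul,
    SpecialLinearGroup.transvection_coe, SpecialLinearGroup.diag2n_coe, diagonal_mul, mul_diagonal,
    Matrix.add_apply, one_apply, single_apply]
  split_ifs <;> grind

/-- A homomorphism from `SL_n` over a field of characteristic zero to a commutative group is
trivial: conjugation by a diagonal matrix turns the transvection with entry `b` into the one with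
entry `4 b`, so that a transvection is a commutator. -/
theorem specialLinearGroup_hom_eq_one {ι F A : Type*} [Fintype ι] [DecidableEq ι] [Nontrivial ι]
    [Field F] [CharZero F] [CommGroup A] (f : SpecialLinearGroup ι F →* A) : f = 1 := by
  have hker : f.ker = ⊤ := by
    refine eq_top_of_transvection_mem _ fun i j hij c => ?_
    -- Since `4 (c / 3) = c / 3 + c`, conjugation of the transvection with entry `c / 3` multiplies
    -- it by the one with entry `c`.
    have h := congrArg f (diag2n_mul_transvection hij 2 (c / 3) two_ne_zero)
    rw [map_mul, map_mul, mul_comm, mul_right_cancel_iff] at h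
    have h3 : SpecialLinearGroup.transvection hij ((2 : F) ^ 2 * (c / 3)) =
        SpecialLinearGroup.transvection hij (c / 3) * SpecialLinearGroup.transvection hij c := by
      rw [← SpecialLinearGroup.transvection_add]
      congr 1
      ring
    rw [h3, map_mul, left_eq_mul] at h
    exact h
  ext g
  have : g ∈ f.ker := hker ▸ Subgroup.mem_top g
  exact this

/-! ### Rational characters of `SL_n` -/

/-- A rational character of `SL_n` has trivial values on adelic points, because its components are
characters of `SL_n` over the completions of `K`. -/
theorem adelicPointsOne_eq_univ {n : ℕ} (hn : 2 ≤ n) (K : Type*) [Field K] [NumberField K] :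
    adelicPointsOne n K = Set.univ := by
  have : Nontrivial (Fin n) := Fin.nontrivial_iff_two_le.2 hn
  refine Set.eq_univ_of_forall fun g χ => ?_
  have hinf : ∀ v : InfinitePlace K, infComp v (χ.toFun _ g : AdeleRing (𝓞 K) K) = 1 := by
    intro v
    let f : AdeleRing (𝓞 K) K →ₐ[K] v.Completion := { infComp v with commutes' := fun _ => rfl }
    have : CharZero v.Completion := charZero_of_injective_algebraMap (algebraMap K _).injective
    have h := χ.natural _ _ f g
    rw [specialLinearGroup_hom_eq_one (χ.toFun v.Completion)] at h
    exact (congrArg Units.val h).symm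
  have hfin : ∀ v : HeightOneSpectrum (𝓞 K),
      finComp v (χ.toFun _ g : AdeleRing (𝓞 K) K) = 1 := by
    intro v
    let f : AdeleRing (𝓞 K) K →ₐ[K] v.adicCompletion K :=
      { finComp v with commutes' := fun _ => rfl }
    have : CharZero (v.adicCompletion K) :=
      charZero_of_injective_algebraMap (algebraMap K _).injective
    have h := χ.natural _ _ f g
    rw [specialLinearGroup_hom_eq_one (χ.toFun (v.adicCompletion K))] at h
    exact (congrArg Units.val h).symm
  simp [adelicNorm, hinf, hfin, infAbs, finAbs]

/-! ### Strong approximation for `SL_n` -/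

variable {K : Type*} [Field K] [NumberField K]

/-- The group `SL_n(O_v)`, as a subgroup of `SL_n(K_v)`. -/
noncomputable def integralSL (n : ℕ) (v : HeightOneSpectrum (𝓞 K)) :
    Subgroup (SpecialLinearGroup (Fin n) (v.adicCompletion K)) :=
  (SpecialLinearGroup.map (v.adicCompletionIntegers K).subtype).range

theorem mem_integralSL_iff {n : ℕ} {v : HeightOneSpectrum (𝓞 K)}
    {g : SpecialLinearGroup (Fin n) (v.adicCompletion K)} :
    g ∈ integralSL n v ↔ ∀ i j, g.1 i j ∈ v.adicCompletionIntegers K := by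
  constructor
  · rintro ⟨k, rfl⟩ i j
    exact (k.1 i j).2
  · intro h
    let k : Matrix (Fin n) (Fin n) (v.adicCompletionIntegers K) := .of fun i j => ⟨g.1 i j, h i j⟩
    have hk : (v.adicCompletionIntegers K).subtype.mapMatrix k = g.1 := rfl
    refine ⟨⟨k, ?_⟩, Subtype.ext hk⟩
    apply (v.adicCompletionIntegers K).subtype_injective
    rw [RingHom.map_det, hk, g.2, map_one]

theorem isOpen_integralSL (n : ℕ) (v : HeightOneSpectrum (𝓞 K)) :
    IsOpen (integralSL n v : Set (SpecialLinearGroup (Fin n) (v.adicCompletion K))) := by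
  have h : (integralSL n v : Set (SpecialLinearGroup (Fin n) (v.adicCompletion K))) =
      ⋂ i, ⋂ j, {g | g.1 i j ∈ v.adicCompletionIntegers K} := by
    ext g
    simp [mem_integralSL_iff]
  rw [h]
  refine isOpen_iInter_of_finite fun i => isOpen_iInter_of_finite fun j => ?_
  have hc : Continuous fun g : SpecialLinearGroup (Fin n) (v.adicCompletion K) => g.1 i j :=
    (continuous_apply_apply i j).comp continuous_subtype_val
  exact (Valued.isOpen_valuationSubring (v.adicCompletion K)).preimage hc

/-- The elements of `K` that are integral at all finite places except possibly `w`. -/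
noncomputable def integersAway (w : HeightOneSpectrum (𝓞 K)) : Subring K :=
  ⨅ v : {v : HeightOneSpectrum (𝓞 K) // v ≠ w}, (v.1.valuation K).valuationSubring.toSubring

theorem mem_integersAway {w : HeightOneSpectrum (𝓞 K)} {x : K} :
    x ∈ integersAway w ↔ ∀ v : HeightOneSpectrum (𝓞 K), v ≠ w → v.valuation K x ≤ 1 := by
  simp [integersAway, Subring.mem_iInf, Valuation.mem_valuationSubring_iff]

/-- An element `x` of `K` becomes integral away from `w` after multiplication by some `c ∈ 𝓞 K` as
close to `1` as desired at `w`. -/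
theorem exists_mul_mem_integersAway (w : HeightOneSpectrum (𝓞 K)) (x : K) (M : ℕ) :
    ∃ c : 𝓞 K, (c : K) * x ∈ integersAway w ∧ c - 1 ∈ w.asIdeal ^ M := by
  classical
  have hex : ∀ v : HeightOneSpectrum (𝓞 K), ∃ e : ℕ,
      WithZero.exp (-(e : ℤ)) * v.valuation K x ≤ 1 := by
    intro v
    by_cases hx : v.valuation K x = 0
    · exact ⟨0, by simp [hx]⟩
    · refine ⟨(WithZero.log (v.valuation K x)).toNat, ?_⟩
      have hlog := WithZero.exp_log hx
      generalize WithZero.log (v.valuation K x) = k at hlog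
      rw [← hlog, ← WithZero.exp_add, ← WithZero.exp_zero, WithZero.exp_le_exp]
      have := Int.self_le_toNat k
      omega
  choose e he using hex
  -- By the Chinese remainder theorem, `c` is divisible at each pole `v ≠ w` of `x` by the power
  -- that clears the pole, and congruent to `1` modulo `w ^ M`.
  let s : Finset (HeightOneSpectrum (𝓞 K)) :=
    insert w (HeightOneSpectrum.Support.finite (𝓞 K) x).toFinset
  obtain ⟨c, hc⟩ := IsDedekindDomain.exists_forall_sub_mem_ideal (s := s)
    (fun v : HeightOneSpectrum (𝓞 K) => v.asIdeal) (fun v => if v = w then M else e v)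
    (fun v _ => v.prime) (fun v _ v' _ h h' => h (HeightOneSpectrum.ext h'))
    (fun v => if v.1 = w then 1 else 0)
  refine ⟨c, mem_integersAway.2 fun v hv => ?_, by simpa using hc w (by simp [s])⟩
  rw [map_mul]
  by_cases hs : v ∈ s
  · have h1 := hc v hs
    simp only [hv, if_false, sub_zero] at h1
    have h2 := (v.intValuation_le_pow_iff_mem c (e v)).2 h1
    rw [← HeightOneSpectrum.valuation_of_algebraMap (K := K)] at h2
    exact (mul_le_mul_left h2 _).trans (he v)
  · have h1 : v.valuation K x ≤ 1 := by
      by_contra hx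
      exact hs (Finset.mem_insert_of_mem ((Set.Finite.mem_toFinset _).2 (not_le.1 hx)))
    exact mul_le_one' (v.valuation_le_one c) h1

/-- Strong approximation for the additive group at the place `w`: the elements of `K` that are
integral away from `w` are dense in `K_w`. -/
theorem dense_integersAway (w : HeightOneSpectrum (𝓞 K)) :
    Dense (algebraMap K (w.adicCompletion K) '' (integersAway w : Set K)) := by
  rw [dense_iff_closure_eq]
  have hK : Set.range (algebraMap K (w.adicCompletion K)) ⊆
      closure (algebraMap K (w.adicCompletion K) '' (integersAway w : Set K)) := by
    rintro _ ⟨x, rfl⟩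
    choose c hc hc1 using exists_mul_mem_integersAway w x
    refine mem_closure_of_tendsto (f := fun M : ℕ =>
      algebraMap K (w.adicCompletion K) ((c M : K) * x)) (b := Filter.atTop) ?_
      (Filter.Eventually.of_forall fun M => ⟨_, hc M, rfl⟩)
    have h1 : Filter.Tendsto (fun M : ℕ => algebraMap K (w.adicCompletion K) ((c M - 1 : 𝓞 K) : K))
        Filter.atTop (nhds 0) := by
      rw [tendsto_zero_iff_norm_tendsto_zero]
      have hlt : WithZeroMulInt.toNNReal (HeightOneSpectrum.absNorm_ne_zero w)
          (WithZero.exp (-1)) < 1 := by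
        rw [WithZeroMulInt.toNNReal_lt_one_iff (HeightOneSpectrum.one_lt_absNorm_nnreal w),
          ← WithZero.exp_zero, WithZero.exp_lt_exp]
        norm_num
      refine squeeze_zero (fun _ => norm_nonneg _) (fun M => ?_)
        (tendsto_pow_atTop_nhds_zero_of_lt_one (NNReal.coe_nonneg _) hlt)
      have h1 := (w.intValuation_le_pow_iff_mem _ _).2 (hc1 M)
      have h2 : ‖algebraMap K (w.adicCompletion K) ((c M - 1 : 𝓞 K) : K)‖ =
          WithZeroMulInt.toNNReal (HeightOneSpectrum.absNorm_ne_zero w)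
            (w.intValuation (c M - 1)) :=
        FinitePlace.norm_embedding_int K w _
      rw [h2, ← NNReal.coe_pow, NNReal.coe_le_coe, ← map_pow, ← WithZero.exp_nsmul]
      exact (WithZeroMulInt.toNNReal_strictMono
        (HeightOneSpectrum.one_lt_absNorm_nnreal w)).monotone (by simpa using h1)
    have h2 := ((h1.add_const 1).mul_const (algebraMap K (w.adicCompletion K) x))
    simp only [zero_add, one_mul] at h2
    refine h2.congr fun M => ?_
    push_cast
    simp
  have hd := (w.denseRange_algebraMap K).closure_eq
  rw [← Set.univ_subset_iff, ← hd]
  exact closure_minimal hK isClosed_closure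

/-- The image of `SL_n(R)` in `SL_n(K_w)`, where `R` consists of the elements of `K` that are
integral away from `w`, is dense. -/
theorem exists_integral_away_mul_mem {n : ℕ} (hn : 2 ≤ n) (w : HeightOneSpectrum (𝓞 K))
    (h : SpecialLinearGroup (Fin n) (w.adicCompletion K)) :
    ∃ γ : SpecialLinearGroup (Fin n) K,
      h * SpecialLinearGroup.map (algebraMap K (w.adicCompletion K)) γ ∈ integralSL n w ∧
      ∀ v : HeightOneSpectrum (𝓞 K), v ≠ w →
        SpecialLinearGroup.map (algebraMap K (v.adicCompletion K)) γ ∈ integralSL n v := by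
  have : Nontrivial (Fin n) := Fin.nontrivial_iff_two_le.2 hn
  let Φ := (SpecialLinearGroup.map (n := Fin n) (algebraMap K (w.adicCompletion K))).comp
    (SpecialLinearGroup.map (integersAway w).subtype)
  -- The closure of the image is a subgroup, so that transvections suffice; these depend
  -- continuously on their entry.
  have htop : Φ.range.topologicalClosure = ⊤ := by
    refine eq_top_of_transvection_mem _ fun i j hij c => ?_
    have hcont : Continuous fun c : w.adicCompletion K =>
        SpecialLinearGroup.transvection hij c := by
      refine continuous_induced_rng.2 ?_
      refine continuous_matrix fun k l => ?_
      change Continuous fun c : w.adicCompletion K =>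
        ((1 : Matrix (Fin n) (Fin n) (w.adicCompletion K)) + single i j c) k l
      simp only [Matrix.add_apply, single_apply]
      split_ifs <;> fun_prop
    refine map_mem_closure hcont (dense_integersAway w c) ?_
    rintro _ ⟨x, hx, rfl⟩
    refine ⟨SpecialLinearGroup.transvection hij ⟨x, hx⟩, ?_⟩
    exact (congrArg _ (map_transvection _ hij _)).trans (map_transvection _ hij _)
  have hmem : h⁻¹ ∈ closure (Φ.range : Set (SpecialLinearGroup (Fin n) (w.adicCompletion K))) := by
    have : h⁻¹ ∈ Φ.range.topologicalClosure := htop ▸ Subgroup.mem_top _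
    exact this
  obtain ⟨_, hg, ⟨γ, rfl⟩⟩ := mem_closure_iff.1 hmem
    ((h * ·) ⁻¹' (integralSL n w : Set (SpecialLinearGroup (Fin n) (w.adicCompletion K))))
    ((isOpen_integralSL n w).preimage (continuous_const_mul h)) (by simp [one_mem])
  refine ⟨SpecialLinearGroup.map (integersAway w).subtype γ, hg, fun v hv => ?_⟩
  rw [mem_integralSL_iff]
  intro i j
  rw [HeightOneSpectrum.mem_adicCompletionIntegers]
  exact (HeightOneSpectrum.valuedAdicCompletion_eq_valuation' v _).trans_le
    (mem_integersAway.1 (γ.1 i j).2 v hv)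

/-- `SL_n(𝔸_f) = SL_n(𝓞̂) SL_n(K)`: strong approximation in terms of the components. -/
theorem exists_mul_map_mem_integralSL {n : ℕ} (hn : 2 ≤ n)
    (h : ∀ v : HeightOneSpectrum (𝓞 K), SpecialLinearGroup (Fin n) (v.adicCompletion K))
    (hfin : {v | h v ∉ integralSL n v}.Finite) :
    ∃ γ : SpecialLinearGroup (Fin n) K, ∀ v : HeightOneSpectrum (𝓞 K),
      h v * SpecialLinearGroup.map (algebraMap K (v.adicCompletion K)) γ ∈ integralSL n v := by
  -- Each place at which `h` is not integral is removed without creating a new one.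
  induction hs : hfin.toFinset.card using Nat.strong_induction_on generalizing h with
  | _ m ih =>
  by_cases hne : ∃ w, h w ∉ integralSL n w
  · obtain ⟨w, hw⟩ := hne
    obtain ⟨γ, hγw, hγ⟩ := exists_integral_away_mul_mem hn w (h w)
    let h' := fun v : HeightOneSpectrum (𝓞 K) =>
      h v * SpecialLinearGroup.map (algebraMap K (v.adicCompletion K)) γ
    have hsub : {v | h' v ∉ integralSL n v} ⊂ {v | h v ∉ integralSL n v} := by
      refine ⟨fun v hv hv' => ?_, fun hsub => hsub hw hγw⟩
      by_cases hvw : v = w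
      · subst hvw
        exact hw hv'
      · exact hv (mul_mem hv' (hγ v hvw))
    have hfin' := hfin.subset hsub.subset
    obtain ⟨δ, hδ⟩ := ih _ (by
      rw [← hs]
      exact Finset.card_lt_card (by simpa using hsub)) h' hfin' rfl
    refine ⟨γ * δ, fun v => ?_⟩
    rw [map_mul, ← mul_assoc]
    exact hδ v
  · push Not at hne
    exact ⟨1, fun v => by simpa using hne v⟩

/-! ### Positive definite matrices and unimodular matrices -/

theorem re_star_dotProduct_self {𝕜 ι : Type*} [RCLike 𝕜] [Fintype ι] (w : ι → 𝕜) :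
    RCLike.re (star w ⬝ᵥ w) = ∑ i, ‖w i‖ ^ 2 := by
  simp only [dotProduct, Pi.star_apply, map_sum]
  refine Finset.sum_congr rfl fun i _ => ?_
  rw [RCLike.star_def, RCLike.conj_mul, ← RCLike.ofReal_pow, RCLike.ofReal_re]

theorem re_star_dotProduct_conjTranspose_mul_self {𝕜 ι : Type*} [RCLike 𝕜] [Fintype ι]
    (B : Matrix ι ι 𝕜) (z : ι → 𝕜) :
    RCLike.re (star z ⬝ᵥ ((Bᴴ * B) *ᵥ z)) = ∑ i, ‖(B *ᵥ z) i‖ ^ 2 := by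
  rw [← re_star_dotProduct_self, ← mulVec_mulVec, dotProduct_mulVec, star_mulVec]

theorem posDef_conjTranspose_mul_self {𝕜 ι : Type*} [RCLike 𝕜] [Fintype ι] [DecidableEq ι]
    (P : SpecialLinearGroup ι 𝕜) : (P.1ᴴ * P.1).PosDef :=
  PosDef.conjTranspose_mul_self _ (mulVec_injective_of_isUnit
    ((isUnit_iff_isUnit_det _).2 (by rw [P.2]; exact isUnit_one)))

theorem det_conjTranspose_mul_self {𝕜 ι : Type*} [RCLike 𝕜] [Fintype ι] [DecidableEq ι]
    (P : SpecialLinearGroup ι 𝕜) : (P.1ᴴ * P.1).det = 1 := by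
  rw [det_mul, det_conjTranspose, P.2, star_one, one_mul]

theorem re_det_pos {𝕜 ι : Type*} [RCLike 𝕜] [Fintype ι] [DecidableEq ι] {A : Matrix ι ι 𝕜}
    (hA : A.PosDef) : 0 < RCLike.re A.det :=
  (RCLike.pos_iff.1 hA.det_pos).1

/-- A positive definite matrix `A` is a multiple of `P* P` for some `P ∈ SL_n`, namely the square
root of `A` divided by the `n`-th root of its determinant, which is a positive real number. -/
theorem exists_specialLinearGroup_of_posDef {𝕜 : Type*} [RCLike 𝕜] {n : ℕ} (hn : n ≠ 0)
    {A : Matrix (Fin n) (Fin n) 𝕜} (hA : A.PosDef) :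
    ∃ P : SpecialLinearGroup (Fin n) 𝕜, ∀ z, RCLike.re (star z ⬝ᵥ (A *ᵥ z)) =
      RCLike.re A.det ^ (1 / (n : ℝ)) * ∑ i, ‖(P.1 *ᵥ z) i‖ ^ 2 := by
  open scoped MatrixOrder in
  have hex : ∃ B : Matrix (Fin n) (Fin n) 𝕜, B.PosDef ∧ Bᴴ * B = A := by
    have hs : (CFC.sqrt A).PosSemidef := (CFC.sqrt_nonneg A).posSemidef
    have hsq : CFC.sqrt A * CFC.sqrt A = A := CFC.sqrt_mul_sqrt_self A hA.posSemidef.nonneg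
    refine ⟨CFC.sqrt A, hs.posDef_iff_det_ne_zero.2 fun h0 => ?_, by rw [hs.1.eq, hsq]⟩
    have := hA.det_pos
    rw [← hsq, det_mul, h0, zero_mul] at this
    exact lt_irrefl _ this
  obtain ⟨B, hB, rfl⟩ := hex
  obtain ⟨hr, him⟩ := RCLike.pos_iff.1 hB.det_pos
  set r := RCLike.re B.det
  have hBr : B.det = (r : 𝕜) := RCLike.ext (by simp [r]) (by simp [him])
  -- The determinant of `Bᴴ * B` is `r ^ 2`, and that of `c • B` is `1`.
  set c : ℝ := (r ^ (1 / (n : ℝ)))⁻¹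
  have hcpos : 0 < c := inv_pos.2 (Real.rpow_pos_of_pos hr _)
  have hn' : (n : ℝ) ≠ 0 := Nat.cast_ne_zero.2 hn
  have hrn : (r ^ (1 / (n : ℝ))) ^ n = r := by
    rw [← Real.rpow_natCast, ← Real.rpow_mul hr.le, one_div_mul_cancel hn', Real.rpow_one]
  have hc : c ^ n * r = 1 := by
    rw [inv_pow, hrn, inv_mul_cancel₀ hr.ne']
  have hdet : ((c : 𝕜) • B).det = 1 := by
    rw [det_smul, Fintype.card_fin, hBr, ← RCLike.ofReal_pow, ← RCLike.ofReal_mul, hc,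
      RCLike.ofReal_one]
  refine ⟨⟨(c : 𝕜) • B, hdet⟩, fun z => ?_⟩
  have hd : RCLike.re (Bᴴ * B).det = r ^ 2 := by
    rw [det_mul, det_conjTranspose, hBr, RCLike.star_def, RCLike.conj_ofReal, ← RCLike.ofReal_mul,
      RCLike.ofReal_re, sq]
  have hs : ∀ i, ‖(((c : 𝕜) • B) *ᵥ z) i‖ ^ 2 = c ^ 2 * ‖(B *ᵥ z) i‖ ^ 2 := by
    intro i
    rw [smul_mulVec, Pi.smul_apply, norm_smul, RCLike.norm_ofReal, mul_pow, sq_abs]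
  simp only [hs]
  rw [re_star_dotProduct_conjTranspose_mul_self, hd, ← Finset.mul_sum, ← mul_assoc,
    ← Real.rpow_natCast r 2, ← Real.rpow_mul hr.le, mul_comm _ (1 / (n : ℝ)), Real.rpow_mul hr.le,
    Real.rpow_natCast, inv_pow, mul_inv_cancel₀ (pow_pos (Real.rpow_pos_of_pos hr _) 2).ne',
    one_mul]

/-! ### Humbert forms as elements of `SL_n(K ⊗ ℝ)` -/

open InfinitePlace in
open scoped Classical in
theorem prod_pow_mult {K : Type*} [Field K] [NumberField K] (f : InfinitePlace K → ℝ) :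
    ∏ w, f w ^ w.mult = (∏ w : {w : InfinitePlace K // w.IsReal}, f w) *
      (∏ w : {w : InfinitePlace K // w.IsComplex}, f w) ^ 2 := by
  rw [prod_eq_prod_mul_prod, ← Finset.prod_pow]
  congr 1
  · exact Finset.prod_congr rfl fun w _ => by rw [mult_isReal, pow_one]
  · exact Finset.prod_congr rfl fun w _ => by rw [mult_isComplex]

/-- For `M ∈ SL_n(K ⊗ ℝ)`, the value at `x ∈ 𝓞_K^n` of the Humbert form with components
`M_w* M_w`: the product over the infinite places of the squared length of `M_w x`, the complex
places counted twice. The algebra `K ⊗ ℝ` is encoded as the mixed space of `K`. -/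
noncomputable def mixedValue {n : ℕ}
    (M : SpecialLinearGroup (Fin n) (mixedEmbedding.mixedSpace K)) (x : Fin n → 𝓞 K) : ℝ :=
  ∏ w : InfinitePlace K,
    (∑ i, mixedEmbedding.normAtPlace w ((M.1 *ᵥ fun j => mixedEmbedding K (x j)) i) ^ 2) ^ w.mult

open scoped Classical in
theorem mixedValue_eq {n : ℕ}
    (M : SpecialLinearGroup (Fin n) (mixedEmbedding.mixedSpace K)) (x : Fin n → 𝓞 K) :
    mixedValue M x =
      (∏ w : {w : InfinitePlace K // w.IsReal}, ∑ i, ‖((Matrix.of fun i j => (M.1 i j).1 w) *ᵥ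
        fun j => InfinitePlace.embedding_of_isReal w.2 (x j : K)) i‖ ^ 2) *
      (∏ w : {w : InfinitePlace K // w.IsComplex}, ∑ i, ‖((Matrix.of fun i j => (M.1 i j).2 w) *ᵥ
        fun j => w.1.embedding (x j : K)) i‖ ^ 2) ^ 2 := by
  rw [mixedValue, prod_pow_mult]
  refine congrArg₂ (· * ·) ?_ (congrArg (· ^ 2) ?_)
  · refine Finset.prod_congr rfl fun w _ => Finset.sum_congr rfl fun i _ => ?_
    rw [mixedEmbedding.normAtPlace_apply_of_isReal w.2]
    simp [mulVec, dotProduct, Prod.fst_sum, Finset.sum_apply]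
  · refine Finset.prod_congr rfl fun w _ => Finset.sum_congr rfl fun i _ => ?_
    rw [mixedEmbedding.normAtPlace_apply_of_isComplex w.2]
    simp [mulVec, dotProduct, Prod.snd_sum, Finset.sum_apply]

/-- The real component of an element of `SL_n(K ⊗ ℝ)`. -/
noncomputable def realComponent {n : ℕ} (w : {w : InfinitePlace K // w.IsReal}) :
    SpecialLinearGroup (Fin n) (mixedEmbedding.mixedSpace K) →* SpecialLinearGroup (Fin n) ℝ :=
  SpecialLinearGroup.map ((Pi.evalRingHom _ w).comp (RingHom.fst _ _))

/-- The complex component of an element of `SL_n(K ⊗ ℝ)`. -/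
noncomputable def complexComponent {n : ℕ} (w : {w : InfinitePlace K // w.IsComplex}) :
    SpecialLinearGroup (Fin n) (mixedEmbedding.mixedSpace K) →* SpecialLinearGroup (Fin n) ℂ :=
  SpecialLinearGroup.map ((Pi.evalRingHom _ w).comp (RingHom.snd _ _))

theorem exists_of_components {K : Type*} [Field K] {n : ℕ}
    (P : {w : InfinitePlace K // w.IsReal} → SpecialLinearGroup (Fin n) ℝ)
    (Q : {w : InfinitePlace K // w.IsComplex} → SpecialLinearGroup (Fin n) ℂ) :
    ∃ M : SpecialLinearGroup (Fin n) (mixedEmbedding.mixedSpace K),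
      (∀ w, realComponent w M = P w) ∧ ∀ w, complexComponent w M = Q w := by
  let M : Matrix (Fin n) (Fin n) (mixedEmbedding.mixedSpace K) :=
    .of fun i j => (fun w => (P w).1 i j, fun w => (Q w).1 i j)
  have hM : M.det = 1 := by
    refine Prod.ext (funext fun w => ?_) (funext fun w => ?_)
    · exact (((Pi.evalRingHom (fun _ => ℝ) w).comp
        (RingHom.fst _ ({w : InfinitePlace K // w.IsComplex} → ℂ))).map_det M).trans (P w).2
    · exact (((Pi.evalRingHom (fun _ => ℂ) w).comp
        (RingHom.snd ({w : InfinitePlace K // w.IsReal} → ℝ) _)).map_det M).trans (Q w).2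
  exact ⟨⟨M, hM⟩, fun _ => rfl, fun _ => rfl⟩

/-- Up to the normalizing factor `det(S)^{1/n}`, every Humbert form comes from an element of
`SL_n(K ⊗ ℝ)`. -/
theorem exists_mixedValue_eq_eval {n : ℕ} (hn : n ≠ 0) (S : HumbertForm K n) :
    ∃ M : SpecialLinearGroup (Fin n) (mixedEmbedding.mixedSpace K), ∀ x,
      S.eval x = S.det ^ (1 / (n : ℝ)) * mixedValue M x := by
  classical
  choose P hP using fun w => exists_specialLinearGroup_of_posDef hn (S.realPart_posDef w)
  choose Q hQ using fun w => exists_specialLinearGroup_of_posDef hn (S.complexPart_posDef w)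
  obtain ⟨M, hMP, hMQ⟩ := exists_of_components P Q
  refine ⟨M, fun x => ?_⟩
  have h1 : ∀ w, 0 ≤ (S.realPart w).det := fun w => (re_det_pos (S.realPart_posDef w)).le
  have h2 : ∀ w, 0 ≤ (S.complexPart w).det.re := fun w => (re_det_pos (S.complexPart_posDef w)).le
  have hdet : S.det ^ (1 / (n : ℝ)) =
      (∏ w, (S.realPart w).det ^ (1 / (n : ℝ))) *
        (∏ w, (S.complexPart w).det.re ^ (1 / (n : ℝ))) ^ 2 := by
    rw [HumbertForm.det, Real.mul_rpow (Finset.prod_nonneg fun w _ => h1 w) (sq_nonneg _),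
      Real.finsetProd_rpow _ _ fun w _ => h1 w, Real.finsetProd_rpow _ _ fun w _ => h2 w,
      ← Real.rpow_natCast, ← Real.rpow_natCast,
      ← Real.rpow_mul (Finset.prod_nonneg fun w _ => h2 w),
      ← Real.rpow_mul (Finset.prod_nonneg fun w _ => h2 w), mul_comm (1 / (n : ℝ))]
  rw [hdet, mixedValue_eq, mul_mul_mul_comm, ← mul_pow, ← Finset.prod_mul_distrib,
    ← Finset.prod_mul_distrib, HumbertForm.eval]
  refine congrArg₂ (· * ·) ?_ (congrArg (· ^ 2) ?_)
  · refine Finset.prod_congr rfl fun w _ => ?_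
    have := hP w fun i => InfinitePlace.embedding_of_isReal w.2 (x i : K)
    rw [star_trivial, ← hMP w] at this
    exact this
  · refine Finset.prod_congr rfl fun w _ => ?_
    have := hQ w fun i => w.1.embedding (x i : K)
    rw [← hMQ w] at this
    exact this

/-- Every element of `SL_n(K ⊗ ℝ)` gives a Humbert form of determinant `1`. -/
theorem exists_eval_eq_mixedValue {n : ℕ}
    (M : SpecialLinearGroup (Fin n) (mixedEmbedding.mixedSpace K)) :
    ∃ S : HumbertForm K n, S.det = 1 ∧ ∀ x, S.eval x = mixedValue M x := by
  let S : HumbertForm K n :=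
    { realPart := fun w => (realComponent w M).1ᴴ * (realComponent w M).1
      complexPart := fun w => (complexComponent w M).1ᴴ * (complexComponent w M).1
      realPart_posDef := fun w => posDef_conjTranspose_mul_self _
      complexPart_posDef := fun w => posDef_conjTranspose_mul_self _ }
  refine ⟨S, ?_, fun x => ?_⟩
  · simp only [HumbertForm.det, S, det_conjTranspose_mul_self, Complex.one_re,
      Finset.prod_const_one, one_pow, mul_one]
  · rw [mixedValue_eq, HumbertForm.eval]
    refine congrArg₂ (· * ·) ?_ (congrArg (· ^ 2) ?_)
    · refine Finset.prod_congr rfl fun w _ => ?_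
      have := re_star_dotProduct_conjTranspose_mul_self (realComponent w M).1
        fun i => InfinitePlace.embedding_of_isReal w.2 (x i : K)
      rw [star_trivial] at this
      exact this
    · refine Finset.prod_congr rfl fun w _ => ?_
      exact re_star_dotProduct_conjTranspose_mul_self (complexComponent w M).1
        fun i => w.1.embedding (x i : K)

theorem HumbertForm.det_pos {n : ℕ} (S : HumbertForm K n) : 0 < S.det :=
  mul_pos (Finset.prod_pos fun w _ => re_det_pos (S.realPart_posDef w))
    (pow_pos (Finset.prod_pos fun w _ => re_det_pos (S.complexPart_posDef w)) 2)

theorem projHermiteHumbert_eq_iSup_mixedValue {n : ℕ} (hn : n ≠ 0) :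
    projHermiteHumbert n K =
      ⨆ M : SpecialLinearGroup (Fin n) (mixedEmbedding.mixedSpace K),
        ⨅ x : {x : Fin n → 𝓞 K // x ≠ 0},
          ENNReal.ofReal (mixedValue M x.1 / contentNorm x.1 ^ 2) := by
  refine le_antisymm (iSup_le fun S => ?_) (iSup_le fun M => ?_)
  · obtain ⟨M, hM⟩ := exists_mixedValue_eq_eval hn S
    refine le_iSup_of_le M (iInf_mono fun x => le_of_eq ?_)
    have := (Real.rpow_pos_of_pos S.det_pos (1 / (n : ℝ))).ne'
    rw [hM, mul_comm (contentNorm x.1 ^ 2), mul_div_mul_left _ _ this]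
  · obtain ⟨S, hS, hSM⟩ := exists_eval_eq_mixedValue M
    refine le_iSup_of_le S (iInf_mono fun x => le_of_eq ?_)
    rw [hS, Real.one_rpow, mul_one, hSM]

/-! ### Finiteness by Minkowski's theorem -/

theorem one_le_contentNorm {n : ℕ} {x : Fin n → 𝓞 K} (hx : x ≠ 0) : 1 ≤ contentNorm x := by
  obtain ⟨i, hi⟩ := Function.ne_iff.1 hx
  have hne : Ideal.absNorm (Ideal.span (Set.range x)) ≠ 0 := by
    rw [Ne, Ideal.absNorm_eq_zero_iff, Ideal.span_eq_bot]
    exact fun h => hi (h _ ⟨i, rfl⟩)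
  unfold contentNorm
  exact_mod_cast Nat.one_le_iff_ne_zero.2 hne

open scoped Classical in
theorem normAtPlace_le_norm (w : InfinitePlace K) (a : mixedEmbedding.mixedSpace K) :
    mixedEmbedding.normAtPlace w a ≤ ‖a‖ := by
  rw [mixedEmbedding.norm_eq_sup'_normAtPlace]
  exact Finset.le_sup' (fun w => mixedEmbedding.normAtPlace w a) (Finset.mem_univ w)

/-- Elements of `SL_n(K ⊗ ℝ)` act on `(K ⊗ ℝ)^n` with determinant `1`. -/
theorem det_restrictScalars_toLin' {n : ℕ}
    (M : SpecialLinearGroup (Fin n) (mixedEmbedding.mixedSpace K)) :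
    LinearMap.det ((Matrix.toLin' M.1).restrictScalars ℝ) = 1 := by
  rw [LinearMap.det_restrictScalars, LinearMap.det_toLin', M.2, map_one]

/-- A vector in the `ℤ`-span of the product basis of `(K ⊗ ℝ)^n` comes from `𝓞_K^n`. -/
theorem exists_mixedEmbedding_eq_of_mem_span {n : ℕ} {z : Fin n → mixedEmbedding.mixedSpace K}
    (hz : z ∈ Submodule.span ℤ
      (Set.range (Pi.basis fun _ : Fin n => mixedEmbedding.latticeBasis K))) :
    ∃ x : Fin n → 𝓞 K, ∀ i, mixedEmbedding K (x i) = z i := by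
  classical
  have hmem : ∀ i, z i ∈ mixedEmbedding.integerLattice K := by
    intro i
    have hle : Submodule.span ℤ
        (Set.range (Pi.basis fun _ : Fin n => mixedEmbedding.latticeBasis K)) ≤
        (mixedEmbedding.integerLattice K).comap
          (LinearMap.proj (R := ℤ) (φ := fun _ : Fin n => mixedEmbedding.mixedSpace K) i) := by
      rw [Submodule.span_le]
      rintro _ ⟨⟨j, k⟩, rfl⟩
      rw [Pi.basis_apply, SetLike.mem_coe, Submodule.mem_comap, LinearMap.proj_apply]
      by_cases hij : i = j
      · subst hij
        rw [Pi.single_eq_same, ← mixedEmbedding.mem_span_latticeBasis]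
        exact Submodule.subset_span ⟨k, rfl⟩
      · rw [Pi.single_eq_of_ne hij]
        exact zero_mem _
    exact hle hz
  choose x hx using hmem
  exact ⟨x, hx⟩

/-- Minkowski's theorem, uniformly for all unimodular images of a lattice: the preimages of the ball
of radius `t` under linear maps of determinant `1` all have the same volume, so that they contain
nonzero lattice points as soon as `t` is large enough. -/
theorem exists_radius_forall_exists_norm_lt {E ι : Type*} [NormedAddCommGroup E] [NormedSpace ℝ E]
    [FiniteDimensional ℝ E] [Nontrivial E] [Finite ι] (b : Module.Basis ι ℝ E) :
    ∃ t : ℕ, ∀ f : E →ₗ[ℝ] E, LinearMap.det f = 1 →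
      ∃ z ∈ Submodule.span ℤ (Set.range b), z ≠ 0 ∧ ‖f z‖ < t := by
  let _ : MeasurableSpace E := borel E
  have _ : BorelSpace E := ⟨rfl⟩
  let μ : MeasureTheory.Measure E := MeasureTheory.Measure.addHaar
  let F : Set E := ZSpan.fundamentalDomain b
  have hF : μ F * 2 ^ Module.finrank ℝ E < ⊤ :=
    ENNReal.mul_lt_top (ZSpan.fundamentalDomain_isBounded b).measure_lt_top
      (ENNReal.pow_lt_top ENNReal.ofNat_lt_top)
  obtain ⟨t, ht⟩ : ∃ t : ℕ, μ F * 2 ^ Module.finrank ℝ E < μ (Metric.ball 0 (t : ℝ)) := by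
    have hmono : Monotone fun t : ℕ => Metric.ball (0 : E) (t : ℝ) :=
      fun s t hst => Metric.ball_subset_ball (Nat.cast_le.2 hst)
    rw [← lt_iSup_iff, ← hmono.measure_iUnion, Metric.iUnion_ball_nat,
      MeasureTheory.measure_univ_of_isAddLeftInvariant]
    exact hF
  refine ⟨t, fun f hdet => ?_⟩
  have hvol : μ F * 2 ^ Module.finrank ℝ E < μ (f ⁻¹' Metric.ball 0 (t : ℝ)) := by
    rw [MeasureTheory.Measure.addHaar_preimage_linearMap _ (hdet ▸ one_ne_zero), hdet]
    simpa using ht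
  have : Countable (Submodule.span ℤ (Set.range b)).toAddSubgroup :=
    inferInstanceAs (Countable (Submodule.span ℤ (Set.range b)))
  obtain ⟨z, hz0, hz⟩ :=
    MeasureTheory.exists_ne_zero_mem_lattice_of_measure_mul_two_pow_lt_measure
      (ZSpan.isAddFundamentalDomain' b μ)
      (s := f ⁻¹' Metric.ball 0 (t : ℝ)) (fun x hx => by
        rw [Set.mem_preimage, mem_ball_zero_iff] at hx ⊢
        rwa [map_neg, norm_neg])
      ((convex_ball 0 (t : ℝ)).linear_preimage f) hvol
  exact ⟨z, z.2, fun h => hz0 (Subtype.ext h), mem_ball_zero_iff.1 hz⟩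

open scoped Classical in
/-- The Hermite-Humbert constant without the content in the denominator is finite. -/
theorem exists_forall_exists_mixedValue_le {n : ℕ} (hn : n ≠ 0) :
    ∃ C : ℝ, ∀ M : SpecialLinearGroup (Fin n) (mixedEmbedding.mixedSpace K),
      ∃ x : Fin n → 𝓞 K, x ≠ 0 ∧ mixedValue M x ≤ C := by
  have : Nonempty (Fin n) := Fin.pos_iff_nonempty.1 (Nat.pos_of_ne_zero hn)
  obtain ⟨t, ht⟩ := exists_radius_forall_exists_norm_lt
    (Pi.basis fun _ : Fin n => mixedEmbedding.latticeBasis K)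
  refine ⟨∏ w : InfinitePlace K, (n * (t : ℝ) ^ 2) ^ w.mult, fun M => ?_⟩
  obtain ⟨z, hz, hz0, hzt⟩ := ht _ (det_restrictScalars_toLin' M)
  obtain ⟨x, hx⟩ := exists_mixedEmbedding_eq_of_mem_span hz
  refine ⟨x, fun h0 => hz0 (funext fun i => ?_), ?_⟩
  · rw [← hx i, h0]
    simp
  · have hxz : (fun j => mixedEmbedding K (x j)) = z := funext hx
    refine Finset.prod_le_prod (fun w _ => by positivity) fun w _ =>
      pow_le_pow_left₀ (by positivity) ?_ _
    have hle : ∀ i ∈ (Finset.univ : Finset (Fin n)),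
        mixedEmbedding.normAtPlace w ((M.1 *ᵥ fun j => mixedEmbedding K (x j)) i) ^ 2 ≤
          (t : ℝ) ^ 2 := by
      intro i _
      refine pow_le_pow_left₀ (mixedEmbedding.normAtPlace_nonneg _ _) ?_ _
      rw [hxz]
      exact (normAtPlace_le_norm w _).trans ((norm_le_pi_norm (M.1 *ᵥ z) i).trans hzt.le)
    simpa using Finset.sum_le_card_nsmul _ _ _ hle

theorem projHermiteHumbert_lt_top {n : ℕ} (hn : n ≠ 0) : projHermiteHumbert n K < ⊤ := by
  obtain ⟨C, hC⟩ := exists_forall_exists_mixedValue_le (K := K) hn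
  rw [projHermiteHumbert_eq_iSup_mixedValue hn]
  refine (iSup_le fun M => ?_).trans_lt (ENNReal.ofReal_lt_top (r := C))
  obtain ⟨x, hx0, hx⟩ := hC M
  refine iInf_le_of_le ⟨x, hx0⟩ (ENNReal.ofReal_le_ofReal ?_)
  have h0 : 0 ≤ mixedValue M x := Finset.prod_nonneg fun w _ => by positivity
  exact (div_le_self h0 (one_le_pow₀ (one_le_contentNorm hx0))).trans hx

/-! ### Local heights -/

/-- The real and the complex local heights in a uniform way. -/
theorem infHeight_pow {n : ℕ} (v : InfinitePlace K) (y : Fin n → v.Completion) :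
    infHeight v y ^ (2 * Module.finrank ℚ K) = (∑ i, ‖y i‖ ^ 2) ^ v.mult := by
  have hm : (Module.finrank ℚ K : ℝ) ≠ 0 := Nat.cast_ne_zero.2 Module.finrank_pos.ne'
  have h0 : (0 : ℝ) ≤ ∑ i, ‖y i‖ ^ 2 := Finset.sum_nonneg fun _ _ => sq_nonneg _
  unfold infHeight infAbs
  split_ifs with hv
  · rw [InfinitePlace.mult, if_pos hv, ← Real.rpow_natCast, Nat.cast_mul, Nat.cast_ofNat]
    simp only [pow_one]
    rw [← Real.rpow_mul h0, one_div_mul_cancel (mul_ne_zero two_ne_zero hm), Real.rpow_one]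
  · rw [InfinitePlace.mult, if_neg hv, mul_comm, pow_mul, ← Real.rpow_mul_natCast h0,
      one_div_mul_cancel hm, Real.rpow_one]

theorem finHeight_le_of_mem_integralSL {n : ℕ} {v : HeightOneSpectrum (𝓞 K)}
    {k : SpecialLinearGroup (Fin n) (v.adicCompletion K)} (hk : k ∈ integralSL n v)
    (y : Fin n → v.adicCompletion K) : finHeight v (k.1 *ᵥ y) ≤ finHeight v y := by
  unfold finHeight
  refine Real.rpow_le_rpow (Real.iSup_nonneg fun _ => finAbs_nonneg _ _) ?_ (by positivity)
  rcases isEmpty_or_nonempty (Fin n) with h | h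
  · simp
  refine ciSup_le fun i => ?_
  rw [mem_integralSL_iff] at hk
  have hk1 : ∀ j, ‖k.1 i j‖ ≤ 1 := by
    intro j
    rw [FinitePlace.norm_def]
    exact_mod_cast (WithZeroMulInt.toNNReal_le_one_iff
      (HeightOneSpectrum.one_lt_absNorm_nnreal v)).2 (hk i j)
  change ‖∑ j, k.1 i j * y j‖ ≤ ⨆ j, finAbs v (y j)
  refine IsUltrametricDist.norm_sum_le_of_forall_le_of_nonneg
    (Real.iSup_nonneg fun j => finAbs_nonneg v (y j)) fun j _ => ?_
  rw [norm_mul]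
  exact (mul_le_of_le_one_left (norm_nonneg _) (hk1 j)).trans
    (le_ciSup (f := fun j => finAbs v (y j)) (Set.finite_range _).bddAbove j)

theorem finHeight_mulVec_of_mem_integralSL {n : ℕ} {v : HeightOneSpectrum (𝓞 K)}
    {k : SpecialLinearGroup (Fin n) (v.adicCompletion K)} (hk : k ∈ integralSL n v)
    (y : Fin n → v.adicCompletion K) : finHeight v (k.1 *ᵥ y) = finHeight v y := by
  refine le_antisymm (finHeight_le_of_mem_integralSL hk y) ?_
  have h := finHeight_le_of_mem_integralSL (inv_mem hk) (k.1 *ᵥ y)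
  rwa [mulVec_mulVec, ← Matrix.SpecialLinearGroup.coe_mul, inv_mul_cancel,
    Matrix.SpecialLinearGroup.coe_one, one_mulVec] at h

/-- The product of the finite local heights of an integral vector in terms of its content. -/
theorem finprod_finHeight_pow {n : ℕ} {x : Fin n → 𝓞 K} (hx : x ≠ 0) :
    (∏ᶠ v : HeightOneSpectrum (𝓞 K), finHeight v fun i => ((x i : K) : v.adicCompletion K)) ^
      (2 * Module.finrank ℚ K) = (contentNorm x ^ 2)⁻¹ := by
  have hm : Module.finrank ℚ K ≠ 0 := Module.finrank_pos.ne'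
  have h := NumberField.absNorm_mul_finprod_finitePlace_eq_one hx
  rw [← finprod_comp_equiv (FinitePlace.equivHeightOneSpectrum (K := K)).symm] at h
  have heq : ∀ v : HeightOneSpectrum (𝓞 K),
      (⨆ i, (FinitePlace.equivHeightOneSpectrum (K := K)).symm v (x i : K)) =
        (finHeight v fun i => ((x i : K) : v.adicCompletion K)) ^ Module.finrank ℚ K := by
    intro v
    rw [finHeight, ← Real.rpow_mul_natCast (Real.iSup_nonneg fun _ => finAbs_nonneg _ _),
      one_div_mul_cancel (Nat.cast_ne_zero.2 hm), Real.rpow_one]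
    exact iSup_congr fun i => FinitePlace.equivHeightOneSpectrum_symm_apply v (x i : K)
  obtain ⟨i, hi⟩ := Function.ne_iff.1 hx
  -- Almost all factors are `1`, so that the power may be moved into the product.
  have hsupp : (Function.mulSupport fun v : HeightOneSpectrum (𝓞 K) =>
      finHeight v fun i => ((x i : K) : v.adicCompletion K)).Finite := by
    refine finite_mulSupport_finHeight (fun i => algebraMap K (AdeleRing (𝓞 K) K) (x i : K))
      (Pi.single i (algebraMap K (AdeleRing (𝓞 K) K) (x i : K)⁻¹)) ?_
    rw [single_dotProduct, ← map_mul, inv_mul_cancel₀, map_one]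
    exact_mod_cast hi
  simp only [heq] at h
  rw [← finprod_pow hsupp] at h
  rw [mul_comm 2, pow_mul, ← inv_pow, contentNorm, ← eq_inv_of_mul_eq_one_right h]

/-! ### Heights of rational vectors under adelic matrices -/

/-- The height of the image of a rational vector under an adelic matrix. -/
noncomputable def twistedHeight {n : ℕ} (g : SpecialLinearGroup (Fin n) (AdeleRing (𝓞 K) K))
    (y : Fin n → K) : ℝ :=
  height (g.1 *ᵥ fun i => algebraMap K (AdeleRing (𝓞 K) K) (y i))

theorem toAdelic_mulVec {n : ℕ} (γ : SpecialLinearGroup (Fin n) K) (y : Fin n → K) :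
    ((toAdelic n K γ).1 *ᵥ fun i => algebraMap K (AdeleRing (𝓞 K) K) (y i)) =
      fun i => algebraMap K (AdeleRing (𝓞 K) K) ((γ.1 *ᵥ y) i) := by
  funext i
  rw [RingHom.map_mulVec]
  rfl

theorem twistedHeight_mul_toAdelic {n : ℕ}
    (g : SpecialLinearGroup (Fin n) (AdeleRing (𝓞 K) K)) (γ : SpecialLinearGroup (Fin n) K)
    (y : Fin n → K) : twistedHeight (g * toAdelic n K γ) y = twistedHeight g (γ.1 *ᵥ y) := by
  rw [twistedHeight, Matrix.SpecialLinearGroup.coe_mul, ← mulVec_mulVec, toAdelic_mulVec,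
    twistedHeight]

theorem twistedHeight_smul {n : ℕ} (g : SpecialLinearGroup (Fin n) (AdeleRing (𝓞 K) K)) (c : Kˣ)
    {y : Fin n → K} (hy : y ≠ 0) : twistedHeight g ((c : K) • y) = twistedHeight g y := by
  obtain ⟨i, hi⟩ := Function.ne_iff.1 hy
  have h := height_smul c (g.1 *ᵥ fun i => algebraMap K (AdeleRing (𝓞 K) K) (y i))
    (Pi.single i (algebraMap K (AdeleRing (𝓞 K) K) (y i)⁻¹) ᵥ* (g⁻¹).1) (by
      rw [← dotProduct_mulVec, mulVec_mulVec, ← Matrix.SpecialLinearGroup.coe_mul, inv_mul_cancel,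
        Matrix.SpecialLinearGroup.coe_one, one_mulVec, single_dotProduct, ← map_mul,
        inv_mul_cancel₀ hi, map_one])
  rw [twistedHeight, twistedHeight, ← h, ← mulVec_smul]
  congr 2
  funext i
  simp

theorem mulVec_ne_zero {K : Type*} [Field K] {n : ℕ} (γ : SpecialLinearGroup (Fin n) K)
    {y : Fin n → K} (hy : y ≠ 0) : γ.1 *ᵥ y ≠ 0 := by
  intro h
  apply hy
  have h2 := congrArg ((γ⁻¹).1 *ᵥ ·) h
  simpa only [mulVec_mulVec, ← Matrix.SpecialLinearGroup.coe_mul, inv_mul_cancel,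
    Matrix.SpecialLinearGroup.coe_one, one_mulVec, mulVec_zero] using h2

/-- The infimum of the twisted heights only depends on the class of `g` modulo `SL_n(K)`. -/
theorem iInf_twistedHeight_mul_toAdelic {n : ℕ}
    (g : SpecialLinearGroup (Fin n) (AdeleRing (𝓞 K) K)) (γ : SpecialLinearGroup (Fin n) K) :
    ⨅ y : {y : Fin n → K // y ≠ 0},
        ENNReal.ofReal (twistedHeight (g * toAdelic n K γ) y.1 ^ 2) =
      ⨅ y : {y : Fin n → K // y ≠ 0}, ENNReal.ofReal (twistedHeight g y.1 ^ 2) := by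
  have hle : ∀ (g : SpecialLinearGroup (Fin n) (AdeleRing (𝓞 K) K))
      (γ : SpecialLinearGroup (Fin n) K),
      ⨅ y : {y : Fin n → K // y ≠ 0}, ENNReal.ofReal (twistedHeight g y.1 ^ 2) ≤
      ⨅ y : {y : Fin n → K // y ≠ 0},
        ENNReal.ofReal (twistedHeight (g * toAdelic n K γ) y.1 ^ 2) := by
    refine fun g γ => le_iInf fun y => ?_
    rw [twistedHeight_mul_toAdelic]
    exact iInf_le (fun y : {y : Fin n → K // y ≠ 0} => ENNReal.ofReal (twistedHeight g y.1 ^ 2))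
      ⟨γ.1 *ᵥ y.1, mulVec_ne_zero γ y.2⟩
  refine le_antisymm ?_ (hle g γ)
  have h := hle (g * toAdelic n K γ) γ⁻¹
  rwa [mul_assoc, ← map_mul, mul_inv_cancel, map_one, mul_one] at h

/-- By the product formula, the infimum may be taken over integral vectors only. -/
theorem iInf_twistedHeight_eq_integral {n : ℕ}
    (g : SpecialLinearGroup (Fin n) (AdeleRing (𝓞 K) K)) :
    ⨅ y : {y : Fin n → K // y ≠ 0}, ENNReal.ofReal (twistedHeight g y.1 ^ 2) =
      ⨅ x : {x : Fin n → 𝓞 K // x ≠ 0},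
        ENNReal.ofReal (twistedHeight g (fun i => (x.1 i : K)) ^ 2) := by
  refine le_antisymm (le_iInf fun x => ?_) (le_iInf fun y => ?_)
  · refine iInf_le (fun y : {y : Fin n → K // y ≠ 0} =>
      ENNReal.ofReal (twistedHeight g y.1 ^ 2)) ⟨fun i => (x.1 i : K), fun h => x.2 ?_⟩
    funext i
    exact RingOfIntegers.ext (congrFun h i)
  · obtain ⟨b, hb⟩ :=
      IsLocalization.exist_integer_multiples_of_finite (nonZeroDivisors (𝓞 K)) y.1
    choose x hx using hb
    have hb0 : ((b : 𝓞 K) : K) ≠ 0 := by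
      exact_mod_cast nonZeroDivisors.ne_zero b.2
    have hxy : (fun i => (x i : K)) = ((Units.mk0 _ hb0 : Kˣ) : K) • y.1 := by
      funext i
      exact (hx i).trans (Algebra.smul_def _ _)
    refine iInf_le_of_le ⟨x, fun h => y.2 ?_⟩ (le_of_eq ?_)
    · funext i
      have := congrFun hxy i
      rw [h] at this
      simpa [hb0] using this.symm
    · rw [hxy, twistedHeight_smul g _ y.2]

theorem highestWeightVector_ne_zero {n : ℕ} (hn : 2 ≤ n) : highestWeightVector n K ≠ 0 :=
  fun h => one_ne_zero (α := K) (by simpa [highestWeightVector] using congrFun h ⟨0, by omega⟩)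

/-- `Q(K) \ SL_n(K)` is the projective space of `K^n`: `SL_n(K)` acts transitively on it, and `Q` is
the stabilizer of the point defined by the highest weight vector. -/
theorem iInf_cosetHeight_eq {n : ℕ} (hn : 2 ≤ n)
    (g : SpecialLinearGroup (Fin n) (AdeleRing (𝓞 K) K)) :
    ⨅ x : Quotient (QuotientGroup.rightRel (lineStabilizer n K)),
        ENNReal.ofReal (cosetHeight g x ^ 2) =
      ⨅ y : {y : Fin n → K // y ≠ 0}, ENNReal.ofReal (twistedHeight g⁻¹ y.1 ^ 2) := by
  have he := highestWeightVector_ne_zero (K := K) hn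
  have key : ∀ γ : SpecialLinearGroup (Fin n) K,
      cosetHeight g (Quotient.mk _ γ) =
        twistedHeight g⁻¹ ((γ⁻¹).1 *ᵥ highestWeightVector n K) := by
    intro γ
    rw [← twistedHeight_mul_toAdelic, map_inv, ← _root_.mul_inv_rev]
    change height _ = height _
    congr 2
    funext i
    simp only [highestWeightVector]
    split_ifs <;> simp
  refine le_antisymm (le_iInf fun y => ?_) (le_iInf fun x => ?_)
  · obtain ⟨γ, hγ⟩ := MulAction.exists_smul_eq (SpecialLinearGroup (Fin n) K)
      (Projectivization.mk K _ he) (Projectivization.mk K y.1 y.2)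
    rw [Projectivization.smul_mk, Projectivization.mk_eq_mk_iff] at hγ
    obtain ⟨c, hc⟩ := hγ
    refine iInf_le_of_le (Quotient.mk _ γ⁻¹) (le_of_eq ?_)
    have hc' : γ.1 *ᵥ highestWeightVector n K = (c : K) • y.1 := hc.symm
    rw [key, inv_inv, hc', twistedHeight_smul _ _ y.2]
  · induction x using Quotient.inductionOn with
    | _ γ =>
    rw [key]
    exact iInf_le (fun y : {y : Fin n → K // y ≠ 0} =>
      ENNReal.ofReal (twistedHeight g⁻¹ y.1 ^ 2)) ⟨_, mulVec_ne_zero _ he⟩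

theorem watanabeSL_eq_iSup_twistedHeight {n : ℕ} (hn : 2 ≤ n) :
    watanabeSL n K = ⨆ g : SpecialLinearGroup (Fin n) (AdeleRing (𝓞 K) K),
      ⨅ y : {y : Fin n → K // y ≠ 0}, ENNReal.ofReal (twistedHeight g y.1 ^ 2) := by
  unfold watanabeSL
  simp only [iInf_cosetHeight_eq hn]
  refine le_antisymm (iSup_le fun g => le_iSup_of_le g.1⁻¹ le_rfl) (iSup_le fun g => ?_)
  refine le_iSup_of_le ⟨g⁻¹, by rw [adelicPointsOne_eq_univ hn]; trivial⟩ ?_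
  rw [inv_inv]

/-! ### Comparison of the adelic and the classical constants -/

theorem normAtPlace_ringEquiv_mixedSpace {K : Type*} [Field K] (w : InfinitePlace K)
    (a : InfiniteAdeleRing K) :
    mixedEmbedding.normAtPlace w (InfiniteAdeleRing.ringEquiv_mixedSpace K a) = ‖a w‖ := by
  rw [InfiniteAdeleRing.ringEquiv_mixedSpace_apply]
  rcases w.isReal_or_isComplex with hw | hw
  · rw [mixedEmbedding.normAtPlace_apply_of_isReal hw]
    exact (InfinitePlace.Completion.isometry_extensionEmbeddingOfIsReal hw).norm_map_of_map_zero
      (map_zero _) _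
  · rw [mixedEmbedding.normAtPlace_apply_of_isComplex hw]
    exact (InfinitePlace.Completion.isometry_extensionEmbedding w).norm_map_of_map_zero
      (map_zero _) _

/-- The projection of the adele ring onto its archimedean part `K ⊗ ℝ`. -/
noncomputable def mixedHom : AdeleRing (𝓞 K) K →+* mixedEmbedding.mixedSpace K :=
  (InfiniteAdeleRing.ringEquiv_mixedSpace K).toRingHom.comp
    (RingHom.fst (InfiniteAdeleRing K) (FiniteAdeleRing (𝓞 K) K))

theorem mixedHom_algebraMap (a : K) :
    mixedHom (algebraMap K (AdeleRing (𝓞 K) K) a) = mixedEmbedding K a :=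
  (InfiniteAdeleRing.mixedEmbedding_eq_algebraMap_comp K).symm

theorem normAtPlace_mixedHom (w : InfinitePlace K) (a : AdeleRing (𝓞 K) K) :
    mixedEmbedding.normAtPlace w (mixedHom a) = ‖infComp w a‖ :=
  normAtPlace_ringEquiv_mixedSpace w a.1

/-- The archimedean part of an adelic matrix, as an element of `SL_n(K ⊗ ℝ)`. -/
noncomputable def mixedPart {n : ℕ} : SpecialLinearGroup (Fin n) (AdeleRing (𝓞 K) K) →*
    SpecialLinearGroup (Fin n) (mixedEmbedding.mixedSpace K) :=
  SpecialLinearGroup.map mixedHom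

theorem prod_infHeight_pow {n : ℕ} (g : SpecialLinearGroup (Fin n) (AdeleRing (𝓞 K) K))
    (x : Fin n → 𝓞 K) :
    (∏ v : InfinitePlace K, infHeight v fun i => infComp v
      ((g.1 *ᵥ fun j => algebraMap K (AdeleRing (𝓞 K) K) (x j)) i)) ^ (2 * Module.finrank ℚ K) =
      mixedValue (mixedPart g) x := by
  rw [← Finset.prod_pow, mixedValue]
  refine Finset.prod_congr rfl fun v _ => ?_
  rw [infHeight_pow]
  congr 1
  refine Finset.sum_congr rfl fun i _ => ?_
  have h : ((mixedPart g).1 *ᵥ fun j => mixedEmbedding K (x j)) i =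
      mixedHom ((g.1 *ᵥ fun j => algebraMap K (AdeleRing (𝓞 K) K) (x j)) i) := by
    simp only [← mixedHom_algebraMap]
    exact (RingHom.map_mulVec mixedHom g.1 _ i).symm
  rw [h, normAtPlace_mixedHom]

/-- If the finite components of `g` are integral, then the twisted height of an integral vector is
the normalized value of the Humbert form that belongs to the archimedean part of `g`. -/
theorem twistedHeight_pow {n : ℕ} (g : SpecialLinearGroup (Fin n) (AdeleRing (𝓞 K) K))
    (hg : ∀ v, SpecialLinearGroup.map (finComp v) g ∈ integralSL n v) {x : Fin n → 𝓞 K}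
    (hx : x ≠ 0) :
    twistedHeight g (fun i => (x i : K)) ^ (2 * Module.finrank ℚ K) =
      mixedValue (mixedPart g) x / contentNorm x ^ 2 := by
  have hfin : ∀ v : HeightOneSpectrum (𝓞 K), (finHeight v fun i => finComp v
      ((g.1 *ᵥ fun j => algebraMap K (AdeleRing (𝓞 K) K) (x j)) i)) =
      finHeight v fun i => ((x i : K) : v.adicCompletion K) := by
    intro v
    rw [← finHeight_mulVec_of_mem_integralSL (hg v)
      (fun i => ((x i : K) : v.adicCompletion K))]
    congr 1
    funext i
    exact RingHom.map_mulVec (finComp v) g.1 _ i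
  rw [twistedHeight, height, mul_pow, prod_infHeight_pow, div_eq_mul_inv,
    ← finprod_finHeight_pow hx]
  simp only [hfin]

/-- Strong approximation: modulo `SL_n(K)`, the finite components of an adelic matrix are
integral. -/
theorem exists_mul_toAdelic_mem_integralSL {n : ℕ} (hn : 2 ≤ n)
    (g : SpecialLinearGroup (Fin n) (AdeleRing (𝓞 K) K)) :
    ∃ γ : SpecialLinearGroup (Fin n) K, ∀ v,
      SpecialLinearGroup.map (finComp v) (g * toAdelic n K γ) ∈ integralSL n v := by
  have hfin : {v | SpecialLinearGroup.map (finComp v) g ∉ integralSL n v}.Finite := by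
    have h : ∀ᶠ v : HeightOneSpectrum (𝓞 K) in Filter.cofinite,
        ∀ i j, finComp v (g.1 i j) ∈ v.adicCompletionIntegers K := by
      rw [Filter.eventually_all]
      intro i
      rw [Filter.eventually_all]
      exact fun j => (g.1 i j).2.2
    refine Set.Finite.subset h fun v hv hv' => hv ?_
    exact mem_integralSL_iff.2 hv'
  obtain ⟨γ, hγ⟩ := exists_mul_map_mem_integralSL hn
    (fun v => SpecialLinearGroup.map (finComp v) g) hfin
  exact ⟨γ, fun v => by rw [map_mul]; exact hγ v⟩

/-- Every element of `SL_n(K ⊗ ℝ)` is the archimedean part of an adelic matrix with trivial finite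
components. -/
theorem exists_mixedPart_eq {n : ℕ}
    (M : SpecialLinearGroup (Fin n) (mixedEmbedding.mixedSpace K)) :
    ∃ g : SpecialLinearGroup (Fin n) (AdeleRing (𝓞 K) K), mixedPart g = M ∧
      ∀ v, SpecialLinearGroup.map (finComp v) g ∈ integralSL n v := by
  let e := InfiniteAdeleRing.ringEquiv_mixedSpace K
  let A : Matrix (Fin n) (Fin n) (AdeleRing (𝓞 K) K) :=
    .of fun i j => (e.symm (M.1 i j), (1 : Matrix (Fin n) (Fin n) (FiniteAdeleRing (𝓞 K) K)) i j)
  have h1 : (RingHom.fst (InfiniteAdeleRing K) (FiniteAdeleRing (𝓞 K) K)).mapMatrix A =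
      (e.symm : _ →+* _).mapMatrix M.1 := rfl
  have h2 : (RingHom.snd (InfiniteAdeleRing K) (FiniteAdeleRing (𝓞 K) K)).mapMatrix A = 1 := rfl
  have hA : A.det = 1 := by
    refine Prod.ext ?_ ?_
    · have := (RingHom.fst (InfiniteAdeleRing K) (FiniteAdeleRing (𝓞 K) K)).map_det A
      rw [h1, ← RingHom.map_det, M.2, map_one] at this
      exact this
    · have := (RingHom.snd (InfiniteAdeleRing K) (FiniteAdeleRing (𝓞 K) K)).map_det A
      rw [h2, det_one] at this
      exact this
  refine ⟨⟨A, hA⟩, Subtype.ext (Matrix.ext fun i j => e.apply_symm_apply (M.1 i j)), fun v => ?_⟩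
  · have : SpecialLinearGroup.map (finComp v) ⟨A, hA⟩ = 1 := by
      refine Subtype.ext (Matrix.ext fun i j => ?_)
      have h3 : (1 : Matrix (Fin n) (Fin n) (FiniteAdeleRing (𝓞 K) K)) i j v =
          (1 : Matrix (Fin n) (Fin n) (v.adicCompletion K)) i j := by
        rw [one_apply, one_apply]
        split_ifs <;> rfl
      exact h3
    rw [this]
    exact one_mem _

theorem ofReal_sq_pow (t : ℝ) (m : ℕ) :
    ENNReal.ofReal (t ^ 2) ^ m = ENNReal.ofReal (t ^ (2 * m)) := by
  rw [← ENNReal.ofReal_pow (sq_nonneg t), pow_mul]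

/-- Positive powers are order automorphisms of `[0, ∞]` and hence commute with suprema and
infima. -/
theorem iSup_iInf_pow {ι : Type*} {κ : ι → Type*} (f : ∀ i, κ i → ℝ≥0∞) {m : ℕ} (hm : m ≠ 0) :
    (⨆ i, ⨅ j, f i j) ^ m = ⨆ i, ⨅ j, f i j ^ m := by
  have he : ∀ a : ℝ≥0∞, a ^ m = ENNReal.orderIsoRpow (m : ℝ) (by positivity) a := fun a => by
    rw [ENNReal.orderIsoRpow_apply, ENNReal.rpow_natCast]
  simp only [he, OrderIso.map_iSup, OrderIso.map_iInf]

theorem watanabeSL_pow {n : ℕ} (hn : 2 ≤ n) :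
    watanabeSL n K ^ Module.finrank ℚ K =
      ⨆ M : SpecialLinearGroup (Fin n) (mixedEmbedding.mixedSpace K),
        ⨅ x : {x : Fin n → 𝓞 K // x ≠ 0},
          ENNReal.ofReal (mixedValue M x.1 / contentNorm x.1 ^ 2) := by
  have key : ∀ g : SpecialLinearGroup (Fin n) (AdeleRing (𝓞 K) K),
      (∀ v, SpecialLinearGroup.map (finComp v) g ∈ integralSL n v) →
      (⨅ y : {y : Fin n → K // y ≠ 0}, ENNReal.ofReal (twistedHeight g y.1 ^ 2)) ^
        Module.finrank ℚ K =
      ⨅ x : {x : Fin n → 𝓞 K // x ≠ 0},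
        ENNReal.ofReal (mixedValue (mixedPart g) x.1 / contentNorm x.1 ^ 2) := by
    intro g hg
    have h := iSup_iInf_pow (ι := Unit) (fun _ (x : {x : Fin n → 𝓞 K // x ≠ 0}) =>
        ENNReal.ofReal (twistedHeight g (fun i => (x.1 i : K)) ^ 2))
      (Module.finrank_pos (R := ℚ) (M := K)).ne'
    rw [iSup_const, iSup_const] at h
    rw [iInf_twistedHeight_eq_integral, h]
    refine iInf_congr fun x => ?_
    rw [ofReal_sq_pow, twistedHeight_pow g hg x.2]
  have hsup : watanabeSL n K ^ Module.finrank ℚ K =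
      ⨆ g : SpecialLinearGroup (Fin n) (AdeleRing (𝓞 K) K),
        (⨅ y : {y : Fin n → K // y ≠ 0}, ENNReal.ofReal (twistedHeight g y.1 ^ 2)) ^
          Module.finrank ℚ K := by
    have h := iSup_iInf_pow (κ := fun _ => Unit)
      (fun (g : SpecialLinearGroup (Fin n) (AdeleRing (𝓞 K) K)) _ =>
        ⨅ y : {y : Fin n → K // y ≠ 0}, ENNReal.ofReal (twistedHeight g y.1 ^ 2))
      (Module.finrank_pos (R := ℚ) (M := K)).ne'
    simp only [iInf_const] at h
    rw [watanabeSL_eq_iSup_twistedHeight hn, h]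
  rw [hsup]
  refine le_antisymm (iSup_le fun g => ?_) (iSup_le fun M => ?_)
  · obtain ⟨γ, hγ⟩ := exists_mul_toAdelic_mem_integralSL hn g
    rw [← iInf_twistedHeight_mul_toAdelic g γ, key _ hγ]
    exact le_iSup_of_le (mixedPart (g * toAdelic n K γ)) le_rfl
  · obtain ⟨g, rfl, hg⟩ := exists_mixedPart_eq M
    exact le_iSup_of_le g (key g hg).ge

/-! ### Imaginary quadratic fields -/

theorem hermitianValue_transpose_star {n : ℕ} (A : Matrix (Fin n) (Fin n) ℂ) (z : Fin n → ℂ) :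
    hermitianValue Aᵀ (star z) = hermitianValue A z := by
  rw [hermitianValue, hermitianValue, star_star, mulVec_transpose, dotProduct_comm,
    dotProduct_mulVec]

/-- Complex conjugation of the embedding corresponds to transposition of the hermitian form, so that
the choice of one of the two conjugate embeddings does not matter. -/
theorem exists_posDef_hermitianValue_eq {K : Type*} [Field K] {n : ℕ} {φ ψ : K →+* ℂ}
    (h : ψ = φ ∨ ψ = ComplexEmbedding.conjugate φ) {A : Matrix (Fin n) (Fin n) ℂ}
    (hA : A.PosDef) :
    ∃ B : Matrix (Fin n) (Fin n) ℂ, B.PosDef ∧ B.det = A.det ∧ ∀ x : Fin n → K,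
      hermitianValue B (fun i => ψ (x i)) = hermitianValue A fun i => φ (x i) := by
  rcases h with rfl | rfl
  · exact ⟨A, hA, rfl, fun _ => rfl⟩
  · exact ⟨Aᵀ, hA.transpose, det_transpose A, fun x =>
      hermitianValue_transpose_star A fun i => φ (x i)⟩

theorem hermitianValue_nonneg {n : ℕ} {A : Matrix (Fin n) (Fin n) ℂ} (hA : A.PosDef)
    (z : Fin n → ℂ) : 0 ≤ hermitianValue A z :=
  hA.posSemidef.re_dotProduct_nonneg z

/-- An imaginary quadratic field has only one infinite place, which is complex and counted twice;
this is why all quantities are squared. -/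
theorem projHermiteHumbert_eq_binaryProjHermite_sq (h2 : Module.finrank ℚ K = 2)
    [IsTotallyComplex K] (σ : K →+* ℂ) :
    projHermiteHumbert 2 K = binaryProjHermite σ ^ 2 := by
  classical
  have hreal : IsEmpty {w : InfinitePlace K // w.IsReal} :=
    ⟨fun w => InfinitePlace.not_isReal_iff_isComplex.2 (IsTotallyComplex.isComplex w.1) w.2⟩
  let w : {w : InfinitePlace K // w.IsComplex} :=
    ⟨InfinitePlace.mk σ, IsTotallyComplex.isComplex _⟩
  have hcard : Fintype.card {w : InfinitePlace K // w.IsComplex} = 1 := by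
    have h := InfinitePlace.card_add_two_mul_card_eq_rank K
    rw [h2, InfinitePlace.nrRealPlaces, Fintype.card_eq_zero, InfinitePlace.nrComplexPlaces] at h
    convert (by omega : Fintype.card {w : InfinitePlace K // w.IsComplex} = 1)
  have hsub : Subsingleton {w : InfinitePlace K // w.IsComplex} :=
    Fintype.card_le_one_iff_subsingleton.1 hcard.le
  have huniv : ∀ f : {w : InfinitePlace K // w.IsComplex} → ℝ, ∏ v, f v = f w :=
    fun f => Fintype.prod_subsingleton f w
  have heval : ∀ (S : HumbertForm K 2) x, S.eval x =
      hermitianValue (S.complexPart w) (fun i => w.1.embedding (x i : K)) ^ 2 := by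
    intro S x
    rw [HumbertForm.eval, huniv, Fintype.prod_empty, one_mul]
  have hdet : ∀ S : HumbertForm K 2, S.det = (S.complexPart w).det.re ^ 2 := by
    intro S
    rw [HumbertForm.det, huniv, Fintype.prod_empty, one_mul]
  have hw : w.1.embedding = σ ∨ w.1.embedding = ComplexEmbedding.conjugate σ :=
    InfinitePlace.embedding_mk_eq σ
  have hw' : σ = w.1.embedding ∨ σ = ComplexEmbedding.conjugate w.1.embedding := by
    rcases hw with h | h
    · exact Or.inl h.symm
    · exact Or.inr (by rw [h]; exact (star_star σ).symm)
  have hterm : ∀ (S : HumbertForm K 2) (A : Matrix (Fin 2) (Fin 2) ℂ), A.PosDef →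
      A.det = (S.complexPart w).det → (∀ x : Fin 2 → K, hermitianValue A (fun i => σ (x i)) =
        hermitianValue (S.complexPart w) fun i => w.1.embedding (x i)) →
      ∀ x, ENNReal.ofReal (S.eval x / (contentNorm x ^ 2 * S.det ^ (1 / ((2 : ℕ) : ℝ)))) =
        ENNReal.ofReal (hermitianValue A (fun i => σ (x i : K)) /
          (contentNorm x * A.det.re ^ (1 / 2 : ℝ))) ^ 2 := by
    intro S A hA hAdet hAS x
    have hd : 0 < A.det.re := re_det_pos hA
    have hN : 0 ≤ contentNorm x := Nat.cast_nonneg _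
    rw [← ENNReal.ofReal_pow (div_nonneg (hermitianValue_nonneg hA _)
      (mul_nonneg hN (Real.rpow_nonneg hd.le _))), div_pow, mul_pow, hAS, heval, hdet, ← hAdet]
    congr 3
    rw [Nat.cast_ofNat, ← Real.rpow_mul_natCast hd.le, ← Real.rpow_natCast,
      ← Real.rpow_mul hd.le, mul_comm]
  have hpow := iSup_iInf_pow
    (fun (S : {S : Matrix (Fin 2) (Fin 2) ℂ // S.PosDef}) (x : {x : Fin 2 → 𝓞 K // x ≠ 0}) =>
      ENNReal.ofReal (hermitianValue S.1 (fun i => σ (x.1 i : K)) /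
        (contentNorm x.1 * S.1.det.re ^ (1 / 2 : ℝ)))) two_ne_zero
  rw [binaryProjHermite, hpow, projHermiteHumbert]
  refine le_antisymm (iSup_le fun S => ?_) (iSup_le fun A => ?_)
  · obtain ⟨A, hA, hAdet, hAS⟩ := exists_posDef_hermitianValue_eq hw' (S.complexPart_posDef w)
    exact le_iSup_of_le ⟨A, hA⟩ (iInf_mono fun x => (hterm S A hA hAdet hAS x.1).le)
  · obtain ⟨B, hB, hBdet, hBA⟩ := exists_posDef_hermitianValue_eq hw A.2
    let S : HumbertForm K 2 :=
      { realPart := fun _ => 1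
        complexPart := fun _ => B
        realPart_posDef := fun v => hreal.elim v
        complexPart_posDef := fun _ => hB }
    exact le_iSup_of_le S
      (iInf_mono fun x => (hterm S A.1 A.2 hBdet.symm (fun x => (hBA x).symm) x.1).ge)

theorem projHermiteHumbert_eq_watanabeSL_pow {n : ℕ} (hn : 2 ≤ n) :
    projHermiteHumbert n K = watanabeSL n K ^ Module.finrank ℚ K := by
  rw [projHermiteHumbert_eq_iSup_mixedValue (by omega), watanabeSL_pow hn]

end HermiteHumbert

theorem mainTheorem2 (K : Type*) [Field K] [NumberField K] :
    (∀ n : ℕ, 2 ≤ n →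
      HermiteHumbert.projHermiteHumbert n K < ⊤ ∧
      HermiteHumbert.watanabeSL n K < ⊤ ∧
      HermiteHumbert.projHermiteHumbert n K =
        HermiteHumbert.watanabeSL n K ^ Module.finrank ℚ K) ∧
    (Module.finrank ℚ K = 2 → IsTotallyComplex K → ∀ σ : K →+* ℂ,
      HermiteHumbert.watanabeSL 2 K = HermiteHumbert.binaryProjHermite σ) := by
  refine ⟨fun n hn => ?_, fun h2 hK σ => ?_⟩
  · have heq := HermiteHumbert.projHermiteHumbert_eq_watanabeSL_pow (K := K) hn
    have hlt := HermiteHumbert.projHermiteHumbert_lt_top (K := K) (n := n) (by omega)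
    refine ⟨hlt, lt_top_iff_ne_top.2 fun htop => ?_, heq⟩
    rw [heq, htop, ENNReal.top_pow Module.finrank_pos.ne'] at hlt
    exact lt_irrefl _ hlt
  · have h := HermiteHumbert.projHermiteHumbert_eq_watanabeSL_pow (K := K) (le_refl 2)
    rw [HermiteHumbert.projHermiteHumbert_eq_binaryProjHermite_sq h2 σ, h2] at h
    exact (ENNReal.pow_right_strictMono two_ne_zero).injective h.symm
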